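/- **Setting.** Let $\vec\xi:\mathbb R^3\to\mathbb R^3$ be a random field with independent coordinates, each a centered Gaussian field with covariance $E\,\xi_i(\vec u)\xi_i(\vec v)=e^{-\|\vec u-\vec v\|^2}$, taken in its infinitely differentiable modification, and let $\vec w$ be a standard Wiener process in $\mathbb R^3$ independent of $\vec\xi$. Let $A$ be a linear operator on $\mathbb R^3$ such that the solution of $dU_t=AU_t\,dt$, $U_0=I$, consists of orthogonal operators for all $t\ge 0$. A *knot* is a smooth closed curve in $\mathbb R^3$ without self-intersections, i.e. a curve with a $2\pi$-periodic $C^2$ parametrization that is injective on $[0,2\pi)$ and has nowhere vanishing derivative; two knots have the same *type* if their images are ambient isotopic in $\mathbb R^3$. Let $\gamma_0$ be a knot with such a parametrization $\vec f_0$, and let $\mu_0(\Delta)=\frac1{2\pi}\int_0^{2\pi}1_\Delta(\vec f_0(s))\,ds$ be its normalized visitation measure. Let $\vec x$ be the (jointly continuous) solution of $$d\vec x(\vec u,t)=A\Big(\vec x(\vec u,t)-\int_{\mathbb R^3}\vec x(\vec v,t)\,\mu_0(d\vec v)\Big)dt+d\vec w(t),\qquad \vec x(\vec u,0)=\vec u,\quad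 \vec u\in\mathbb R^3 ,$$ and for $t\ge0$ let $\Gamma_t=\vec\xi(\vec x(\gamma_0,t))$, the closed curve parametrized by $s\mapsto\vec\xi(\vec x(\vec f_0(s),t))$. **Theorem 3.2.** Let $G_1,G_2$ be any two deterministic knots of different types. Then there is a time $t_0>0$ such that $$\{\,\Gamma_0\text{ is a knot of type }G_1\text{ and }\Gamma_{t_0}\text{ is a knot of type }G_2\,\}$$ is, up to a null set, a random event, and it has positive probability. On this event $\Gamma_0$ and $\Gamma_{t_0}$ are knots of different types, so the moving random knot changes its topological type with positive probability. -/

import Mathlib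

open MeasureTheory ProbabilityTheory
open scoped NNReal ENNReal

noncomputable section

namespace RandomKnot

/-- Euclidean three-space. -/
abbrev E3 : Type := EuclideanSpace ℝ (Fin 3)

/-- `γ` is a `2π`-periodic `C²` parametrization of a smooth (regular) closed curve in three-space
without self-intersections. -/
structure IsKnot (γ : ℝ → E3) : Prop where
  contDiff : ContDiff ℝ 2 γ
  periodic : Function.Periodic γ (2 * Real.pi)
  injOn : Set.InjOn γ (Set.Ico 0 (2 * Real.pi))
  deriv_ne_zero : ∀ s, deriv γ s ≠ 0

/-- Ambient isotopy of subsets of three-space: there is a jointly continuous path of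
homeomorphisms of the space which starts at the identity and ends at a homeomorphism that carries
`K` onto `L`. -/
def AmbientIsotopic (K L : Set E3) : Prop :=
  ∃ H : unitInterval → E3 ≃ₜ E3,
    Continuous (fun p : unitInterval × E3 => H p.1 p.2) ∧
    H 0 = Homeomorph.refl E3 ∧ H 1 '' K = L

/-- The closed curves parametrized by `γ` and `g` are of the same topological type. -/
def SameType (γ g : ℝ → E3) : Prop :=
  AmbientIsotopic (Set.range γ) (Set.range g)

/-- The curve parametrized by `γ` is a knot, of the same type as `g`. -/
def HasType (γ g : ℝ → E3) : Prop :=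
  IsKnot γ ∧ SameType γ g

/-- The (normalized) visitation measure of the closed curve parametrized by `f` on `[0, 2π]`:
the image under `f` of the uniform probability measure on `[0, 2π]`. -/
def visitationMeasure (f : ℝ → E3) : Measure E3 :=
  (ENNReal.ofReal (2 * Real.pi))⁻¹ • (volume.restrict (Set.Icc 0 (2 * Real.pi))).map f

/-- `A` generates a semigroup of orthogonal operators: the solution of `dU_t = A U_t dt`,
`U_0 = I`, consists of orthogonal operators for `t ≥ 0`. -/
def GeneratesOrthogonal (A : E3 →L[ℝ] E3) : Prop :=
  ∃ U : ℝ → E3 →L[ℝ] E3, U 0 = 1 ∧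
    (∀ t, 0 ≤ t → HasDerivWithinAt U (A * U t) (Set.Ici 0) t) ∧
    ∀ t, 0 ≤ t → U t ∈ unitary (E3 →L[ℝ] E3)

variable {Ω : Type*} [MeasurableSpace Ω]

/-- A random field `ξ` from three-space to itself whose coordinates are independent centered
Gaussian fields with covariance `exp (-‖u - v‖²)`, in an infinitely differentiable modification. -/
structure IsGaussianField (ξ : E3 → Ω → E3) (P : Measure Ω) : Prop where
  measurable : ∀ u, Measurable (ξ u)
  gaussian : ∀ i : Fin 3, IsGaussianProcess (fun u ω => ξ u ω i) P
  mean : ∀ (i : Fin 3) (u : E3), ∫ ω, ξ u ω i ∂P = 0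
  covariance : ∀ (i : Fin 3) (u v : E3),
    ∫ ω, ξ u ω i * ξ v ω i ∂P = Real.exp (-‖u - v‖ ^ 2)
  indep : iIndepFun (fun (i : Fin 3) ω (u : E3) => ξ u ω i) P
  smooth : ∀ᵐ ω ∂P, ContDiff ℝ (⊤ : ℕ∞) (fun u => ξ u ω)

/-- A standard Wiener process in three-space: its coordinates are independent standard
one-dimensional Brownian motions. -/
structure IsWiener (w : ℝ≥0 → Ω → E3) (P : Measure Ω) : Prop where
  measurable : ∀ t, Measurable (w t)
  brownian : ∀ i : Fin 3, IsBrownianReal (fun t ω => w t ω i) P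
  indep : iIndepFun (fun (i : Fin 3) ω (t : ℝ≥0) => w t ω i) P

/-- `x` solves the equation with interaction
`dx(u,t) = A (x(u,t) - ∫ x(v,t) μ₀(dv)) dt + dw(t)`, `x(u,0) = u`. Almost surely `x` is jointly
continuous and satisfies the integrated equation for all `u` and `t` (the noise is additive, so
no stochastic integral is needed). -/
def IsSolution (A : E3 →L[ℝ] E3) (μ₀ : Measure E3) (w : ℝ≥0 → Ω → E3)
    (x : E3 → ℝ≥0 → Ω → E3) (P : Measure Ω) : Prop :=
  ∀ᵐ ω ∂P, Continuous (fun p : E3 × ℝ≥0 => x p.1 p.2 ω) ∧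
    ∀ (u : E3) (t : ℝ≥0),
      x u t ω = u
        + (∫ s in (0 : ℝ)..t, A (x u s.toNNReal ω - ∫ v, x v s.toNNReal ω ∂μ₀))
        + w t ω

/-- The parametrization `s ↦ ξ (x (f₀ s, t))` of the moving random curve `Γ_t = ξ (γ_t)`, where
`γ_t` is the image of the initial curve `f₀` under the flow `x (·, t)`. -/
def movingKnot (ξ : E3 → Ω → E3) (x : E3 → ℝ≥0 → Ω → E3) (f₀ : ℝ → E3)
    (t : ℝ≥0) (ω : Ω) : ℝ → E3 :=
  fun s => ξ (x (f₀ s) t ω) ω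

end RandomKnot

end

/-! ### Ambient isotopy and stability of the knot type under Lipschitz-small perturbations. -/

namespace RandomKnot

/-! The noise and the mean-field term do not depend on the starting point, so differences of
solutions evolve by `U t`. Averaging over the initial measure gives x(u,t) = m + U_t(u - m) + w(t)
with m the centre of mass (`flow_eq`). The curve fed into ξ at time t is thus a rigid copy of the
initial one, shifted by w(t).

Fix a shift b so large that the initial knot and its copy at time 1, shifted by b, are disjoint
(`IsKnot.exists_isLink`). The vector w(1) lies near b with positive probability. One smooth random
map ξ then acts on two disjoint curves, and it suffices that with positive probability it carries
the first near G₁ and the second near G₂ in C¹. Independence of ξ and w multiplies the two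
probabilities.

Three facts make this work. Knot type is stable under perturbations small in the Lipschitz seminorm
(`IsKnot.exists_stable`): such a perturbation extends to a map of space of the form identity plus
contraction, which is isotopic to the identity. Combinations of the kernels exp(-‖x - u‖²) are C¹
dense on a link (`IsLink.exists_kernelSpan_close`), by a Nachbin-type version of the
Stone–Weierstrass theorem. Each such combination lies in the C¹ support of the field
(`IsGaussianField.measure_lipSmall_sub_pos`), by splitting off one Gaussian variable that represents
it and a small-ball estimate for the independent remainder.

Measurability of the event also rests on stability: among C² loops a knot type is a countable union
of C¹ balls (`exists_measurableSet_hasType`). -/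

theorem AmbientIsotopic.symm {K L : Set E3} (h : AmbientIsotopic K L) : AmbientIsotopic L K := by
  obtain ⟨H, hc, h0, h1⟩ := h
  -- Running the path backwards after undoing only its endpoint avoids any continuity of the
  -- inverses in t.
  refine ⟨fun t => (H 1).symm.trans (H (unitInterval.symm t)), ?_, ?_, ?_⟩
  · exact hc.comp ((unitInterval.continuous_symm.comp continuous_fst).prodMk
      ((H 1).symm.continuous.comp continuous_snd))
  · ext x : 1
    simp
  · subst h1
    ext x
    simp [h0]

theorem AmbientIsotopic.trans {K L M : Set E3} (h : AmbientIsotopic K L)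
    (h' : AmbientIsotopic L M) : AmbientIsotopic K M := by
  obtain ⟨H, hc, h0, h1⟩ := h
  obtain ⟨H', hc', h0', h1'⟩ := h'
  refine ⟨fun t => (H t).trans (H' t), ?_, ?_, ?_⟩
  · exact hc'.comp (continuous_fst.prodMk hc)
  · ext x : 1
    simp [h0, h0']
  · subst h1
    subst h1'
    ext x
    simp

/-- A Lipschitz perturbation of the identity, with constant less than one, is a homeomorphism. -/
noncomputable def idAddHomeomorph (Φ : E3 → E3) {c : ℝ≥0} (hΦ : LipschitzWith c Φ) (hc : c < 1) :
    E3 ≃ₜ E3 :=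
  ApproximatesLinearOn.toHomeomorph (f' := ContinuousLinearEquiv.refl ℝ E3) (c := c)
    (fun x => x + Φ x)
    (by
      intro x _ y _
      have := hΦ.dist_le_mul x y
      rw [dist_eq_norm, dist_eq_norm] at this
      have e : x + Φ x - (y + Φ y) -
          ((ContinuousLinearEquiv.refl ℝ E3 : E3 ≃L[ℝ] E3) : E3 →L[ℝ] E3) (x - y) = Φ x - Φ y := by
        change x + Φ x - (y + Φ y) - (x - y) = Φ x - Φ y
        abel
      rw [e]
      exact this)
    (Or.inr (by
      have h : ‖(ContinuousLinearEquiv.refl ℝ E3 : E3 →L[ℝ] E3)‖₊ = 1 := by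
        have := ContinuousLinearMap.norm_id (𝕜 := ℝ) (E := E3)
        exact NNReal.eq this
      change c < ‖(ContinuousLinearEquiv.refl ℝ E3 : E3 →L[ℝ] E3)‖₊⁻¹
      rw [h]
      simpa using hc))

theorem idAddHomeomorph_apply (Φ : E3 → E3) {c : ℝ≥0} (hΦ : LipschitzWith c Φ) (hc : c < 1)
    (x : E3) : idAddHomeomorph Φ hΦ hc x = x + Φ x := rfl

/-- The isotopy is x + tΦ(x): each tΦ is still a contraction, so every stage is a homeomorphism. -/
theorem ambientIsotopic_image_of_lipschitz (Φ : E3 → E3) {c : ℝ≥0} (hΦ : LipschitzWith c Φ)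
    (hc : c < 1) (K : Set E3) : AmbientIsotopic K ((fun x => x + Φ x) '' K) := by
  have hL : ∀ t : unitInterval, LipschitzWith c (fun x => (t : ℝ) • Φ x) := by
    intro t
    refine LipschitzWith.of_dist_le_mul fun x y => ?_
    rw [dist_smul₀]
    have h1 := hΦ.dist_le_mul x y
    have h2 : ‖(t : ℝ)‖ ≤ 1 := by
      rw [Real.norm_eq_abs, abs_of_nonneg t.2.1]
      exact t.2.2
    calc _ ≤ 1 * dist (Φ x) (Φ y) := by gcongr
      _ ≤ _ := by simpa using h1
  refine ⟨fun t => idAddHomeomorph _ (hL t) hc, ?_, ?_, ?_⟩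
  · simp only [idAddHomeomorph_apply]
    have := hΦ.continuous
    fun_prop
  · ext x : 1
    simp [idAddHomeomorph_apply]
  · ext x
    simp [idAddHomeomorph_apply]

theorem IsKnot.exists_int_of_eq {G : ℝ → E3} (hG : IsKnot G) {s s' : ℝ} (h : G s = G s') :
    ∃ n : ℤ, s - s' = n * (2 * Real.pi) := by
  have hp := Real.two_pi_pos
  have key : ∀ r, G (toIcoMod hp 0 r) = G r := fun r => by
    rw [toIcoMod]
    exact hG.periodic.sub_zsmul_eq _
  have hmem : ∀ r, toIcoMod hp 0 r ∈ Set.Ico 0 (2 * Real.pi) := fun r => by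
    simpa using toIcoMod_mem_Ico hp 0 r
  have h1 : toIcoMod hp 0 s = toIcoMod hp 0 s' :=
    hG.injOn (hmem s) (hmem s') (by rw [key, key, h])
  refine ⟨toIcoDiv hp 0 s - toIcoDiv hp 0 s', ?_⟩
  rw [toIcoMod, toIcoMod] at h1
  push_cast
  simp only [zsmul_eq_mul] at h1
  linarith

/-- The average `q` of the derivative over a segment extends the difference quotient continuously to
the diagonal. It vanishes nowhere for |z| ≤ π: off the diagonal by injectivity, on it by regularity.
Compactness gives a positive minimum. The bound π keeps away from the next period. -/
theorem IsKnot.exists_antilipschitz {G : ℝ → E3} (hG : IsKnot G) :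
    ∃ c : ℝ, 0 < c ∧ ∀ s s', |s - s'| ≤ Real.pi → c * |s - s'| ≤ ‖G s - G s'‖ := by
  have hpi := Real.pi_pos
  have hd : Continuous (deriv G) := hG.contDiff.continuous_deriv (by norm_num)
  have hD : ∀ s, HasDerivAt G (deriv G s) s := fun s =>
    (hG.contDiff.differentiable (by norm_num) s).hasDerivAt
  let q : ℝ × ℝ → E3 := fun p => ∫ r in (0 : ℝ)..1, deriv G (p.2 + r • p.1)
  have hq : Continuous q := by
    apply intervalIntegral.continuous_parametric_intervalIntegral_of_continuous'
    simp only [Function.uncurry_def]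
    fun_prop
  have hqe : ∀ z s', z • q (z, s') = G (s' + z) - G s' := fun z s' =>
    intervalIntegral.integral_unitInterval_deriv_eq_sub (f := G) (f' := deriv G)
      (z₀ := s') (z₁ := z)
      (by fun_prop) (fun t _ => hD _)
  have hK : IsCompact (Set.Icc (-Real.pi) Real.pi ×ˢ Set.Icc 0 (2 * Real.pi)) :=
    isCompact_Icc.prod isCompact_Icc
  obtain ⟨p, hp, hmin⟩ := hK.exists_isMinOn ⟨(0, 0), by constructor <;> constructor <;> linarith⟩
    hq.norm.continuousOn
  have hne : q p ≠ 0 := by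
    intro h0
    obtain ⟨z, s'⟩ := p
    have h1 := hqe z s'
    rw [h0, smul_zero] at h1
    obtain ⟨n, hn⟩ := hG.exists_int_of_eq (sub_eq_zero.1 h1.symm)
    have hz : z = n * (2 * Real.pi) := by linarith
    have hz1 : |(n : ℝ)| * (2 * Real.pi) ≤ Real.pi := by
      rw [← abs_of_pos Real.two_pi_pos, ← abs_mul, ← hz]
      exact abs_le.2 hp.1
    have hn0 : n = 0 := by
      by_contra hn0
      have : (1 : ℝ) ≤ |(n : ℝ)| := by exact_mod_cast Int.one_le_abs hn0
      nlinarith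
    have hz0 : z = 0 := by simp [hz, hn0]
    have : q (z, s') = deriv G s' := by simp [q, hz0]
    exact hG.deriv_ne_zero s' (this ▸ h0)
  refine ⟨‖q p‖, norm_pos_iff.2 hne, ?_⟩
  have key : ∀ s', s' ∈ Set.Icc 0 (2 * Real.pi) → ∀ z, |z| ≤ Real.pi →
      ‖q p‖ * |z| ≤ ‖G (s' + z) - G s'‖ := by
    intro s' hs' z hz
    rw [← hqe, norm_smul, mul_comm, Real.norm_eq_abs]
    exact mul_le_mul_of_nonneg_left (hmin (Set.mk_mem_prod (abs_le.1 hz) hs')) (abs_nonneg z)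
  intro s s' hss
  have h2 := key (toIcoMod Real.two_pi_pos 0 s')
    (Set.Ico_subset_Icc_self (by simpa using toIcoMod_mem_Ico Real.two_pi_pos 0 s')) (s - s') hss
  have e1 : G (toIcoMod Real.two_pi_pos 0 s') = G s' := hG.periodic.sub_zsmul_eq _
  have e2 : G (toIcoMod Real.two_pi_pos 0 s' + (s - s')) = G s := by
    rw [toIcoMod, show s' - toIcoDiv Real.two_pi_pos 0 s' • (2 * Real.pi) + (s - s')
      = s - toIcoDiv Real.two_pi_pos 0 s' • (2 * Real.pi) by ring]
    exact hG.periodic.sub_zsmul_eq _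
  rwa [e1, e2] at h2

/-- A perturbation of a knot that is small in the Lipschitz seminorm is a knot of the same type. -/
theorem IsKnot.exists_stable {G : ℝ → E3} (hG : IsKnot G) :
    ∃ ε : ℝ≥0, 0 < ε ∧ ∀ γ : ℝ → E3, ContDiff ℝ 2 γ → Function.Periodic γ (2 * Real.pi) →
      LipschitzWith ε (fun s => γ s - G s) → HasType γ G := by
  obtain ⟨c, hc, hcG⟩ := hG.exists_antilipschitz
  lift c to ℝ≥0 using hc.le
  have hc : 0 < c := hc
  set C := lipschitzExtensionConstant E3 with hC
  have hC0 : 0 < C := lipschitzExtensionConstant_pos E3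
  -- `K < 1` keeps the perturbed curve regular; `C * K < 1` makes the extended displacement a
  -- contraction, as extension costs the factor `C`.
  set K : ℝ≥0 := min (1 / 2) (1 / (2 * C)) with hKdef
  have hK0 : 0 < K := by positivity
  have hK1 : K < 1 := (min_le_left _ _).trans_lt (by
    rw [← NNReal.coe_lt_coe]; push_cast; norm_num)
  have hCK : C * K < 1 := by
    calc C * K ≤ C * (1 / (2 * C)) := by gcongr; exact min_le_right _ _
      _ = 1 / 2 := by field_simp
      _ < 1 := by rw [← NNReal.coe_lt_coe]; push_cast; norm_num
  refine ⟨K * c, by positivity, fun γ hγ hper hlip => ?_⟩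
  set h : ℝ → E3 := fun s => γ s - G s with hh
  have hhper : Function.Periodic h (2 * Real.pi) := fun s => by
    simp only [hh, hper s, hG.periodic s]
  have hbound : ∀ a b, ‖h a - h b‖ ≤ K * ‖G a - G b‖ := by
    intro a b
    set n := round ((a - b) / (2 * Real.pi)) with hn
    have hab : |a - (b + n * (2 * Real.pi))| ≤ Real.pi := by
      have h1 := abs_sub_round ((a - b) / (2 * Real.pi))
      have h2 : a - (b + n * (2 * Real.pi)) = ((a - b) / (2 * Real.pi) - n) * (2 * Real.pi) := by
        have := Real.pi_pos.ne'
        field_simp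
        ring
      rw [h2, abs_mul, abs_of_pos Real.two_pi_pos]
      have := Real.pi_pos
      nlinarith
    have e1 : h (b + n * (2 * Real.pi)) = h b := by simpa using hhper.int_mul n b
    have e2 : G (b + n * (2 * Real.pi)) = G b := by simpa using hG.periodic.int_mul n b
    rw [← e1, ← e2]
    have h1 := hlip.dist_le_mul a (b + n * (2 * Real.pi))
    rw [dist_eq_norm, Real.dist_eq] at h1
    push_cast at h1
    have h2 := hcG _ _ hab
    calc _ ≤ K * c * |a - (b + n * (2 * Real.pi))| := h1
      _ = K * (c * |a - (b + n * (2 * Real.pi))|) := by ring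
      _ ≤ _ := by gcongr
  -- The displacement as a function of the point of the knot. The choice of preimage is harmless,
  -- since `hbound` makes `h` constant on the fibres of `G`.
  set φ : E3 → E3 := fun x => h (Function.invFun G x) with hφ
  have hinv : ∀ s, G (Function.invFun G (G s)) = G s := fun s =>
    Function.invFun_eq ⟨s, rfl⟩
  have hφl : LipschitzOnWith K φ (Set.range G) := by
    refine LipschitzOnWith.of_dist_le_mul ?_
    rintro _ ⟨a, rfl⟩ _ ⟨b, rfl⟩
    rw [dist_eq_norm, dist_eq_norm]
    have := hbound (Function.invFun G (G a)) (Function.invFun G (G b))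
    rwa [hinv, hinv] at this
  have hφG : ∀ s, φ (G s) = h s := fun s => by
    have := hbound (Function.invFun G (G s)) s
    rw [hinv, sub_self, norm_zero, mul_zero] at this
    exact sub_eq_zero.1 (norm_le_zero_iff.1 this)
  obtain ⟨Φ, hΦ, hΦe⟩ := hφl.extend_finite_dimension
  have hΦG : ∀ s, G s + Φ (G s) = γ s := fun s => by
    rw [← hΦe ⟨s, rfl⟩, hφG]
    simp [hh]
  have hinj : Function.Injective (fun x => x + Φ x) := (idAddHomeomorph Φ hΦ hCK).injective
  refine ⟨⟨hγ, hper, ?_, ?_⟩, ?_⟩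
  · intro a ha b hb hab
    rw [← hΦG, ← hΦG] at hab
    exact hG.injOn ha hb (hinj hab)
  · intro s hs
    have hdγ : HasDerivAt γ 0 s := by
      rw [← hs]
      exact (hγ.differentiable (by norm_num) s).hasDerivAt
    -- `Φ` is only Lipschitz, so there is no chain rule; a lower bound on difference quotients
    -- replaces it.
    have hlow : ∀ᶠ t in nhdsWithin s {s}ᶜ, (c - K * c : ℝ) ≤ ‖slope γ s t‖ := by
      have h1 : ∀ᶠ t in nhdsWithin s {s}ᶜ, |t - s| < Real.pi :=
        nhdsWithin_le_nhds (Metric.ball_mem_nhds s Real.pi_pos)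
      filter_upwards [h1, self_mem_nhdsWithin] with t ht hts
      have hts' : 0 < |t - s| := abs_pos.2 (sub_ne_zero.2 hts)
      rw [slope_def_module, norm_smul, norm_inv, Real.norm_eq_abs,
        inv_mul_eq_div, le_div_iff₀ hts']
      have e : γ t - γ s = (G t - G s) + (h t - h s) := by simp only [hh]; abel
      have h2 := hcG t s ht.le
      have h3 := hlip.dist_le_mul t s
      rw [dist_eq_norm, Real.dist_eq] at h3
      push_cast at h3
      have h4 := norm_sub_norm_le (G t - G s) (-(h t - h s))
      rw [norm_neg, sub_neg_eq_add, ← e] at h4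
      linarith
    have hlim := (hasDerivAt_iff_tendsto_slope.1 hdγ).norm
    have := ge_of_tendsto hlim hlow
    rw [norm_zero] at this
    have h5 : (K : ℝ) < 1 := hK1
    have h6 : (0 : ℝ) < c := hc
    nlinarith
  · refine AmbientIsotopic.symm ?_
    have := ambientIsotopic_image_of_lipschitz Φ hΦ hCK (Set.range G)
    rwa [← Set.range_comp, show (fun x => x + Φ x) ∘ G = γ from funext hΦG] at this

end RandomKnot

/-! ### The flow with interaction is a rigid motion. -/

namespace RandomKnot

theorem isProbabilityMeasure_visitationMeasure {f : ℝ → E3} (hf : Continuous f) :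
    IsProbabilityMeasure (visitationMeasure f) := by
  constructor
  rw [visitationMeasure, Measure.smul_apply, Measure.map_apply hf.measurable MeasurableSet.univ,
    Set.preimage_univ, Measure.restrict_apply_univ, Real.volume_Icc, sub_zero, smul_eq_mul]
  exact ENNReal.inv_mul_cancel (by simpa using Real.pi_pos) ENNReal.ofReal_ne_top

theorem integrable_visitationMeasure {f : ℝ → E3} (hf : Continuous f) {F : E3 → E3}
    (hF : Continuous F) : Integrable F (visitationMeasure f) := by
  refine Integrable.smul_measure ?_ (ENNReal.inv_ne_top.2 (by simpa using Real.pi_pos))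
  rw [integrable_map_measure hF.aestronglyMeasurable hf.aemeasurable]
  exact (hF.comp hf).continuousOn.integrableOn_Icc

theorem integral_visitationMeasure {f : ℝ → E3} (hf : Continuous f) {F : E3 → E3}
    (hF : Continuous F) : ∫ v, F v ∂(visitationMeasure f) =
      (2 * Real.pi)⁻¹ • ∫ r in (0 : ℝ)..(2 * Real.pi), F (f r) := by
  rw [visitationMeasure, integral_smul_measure, integral_map hf.aemeasurable
    hF.aestronglyMeasurable, integral_Icc_eq_integral_Ioc,
    intervalIntegral.integral_of_le Real.two_pi_pos.le, ENNReal.toReal_inv,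
    ENNReal.toReal_ofReal Real.two_pi_pos.le]

/-- Uniqueness for a linear equation, in its right-derivative form because `U` is controlled only on
the half-line. -/
theorem eq_of_integral_eq {A : E3 →L[ℝ] E3} {U : ℝ → E3 →L[ℝ] E3} (hU0 : U 0 = 1)
    (hU : ∀ t, 0 ≤ t → HasDerivWithinAt U (A * U t) (Set.Ici 0) t) {y : ℝ → E3} {z : E3}
    (hyc : Continuous y) (hy : ∀ t, 0 ≤ t → y t = z + ∫ s in (0 : ℝ)..t, A (y s)) {t : ℝ}
    (ht : 0 ≤ t) : y t = U t z := by
  have hUz : ∀ r, 0 ≤ r → HasDerivWithinAt (fun r => U r z) (A (U r z)) (Set.Ici 0) r :=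
    fun r hr => by simpa using (hU r hr).clm_apply (hasDerivWithinAt_const r (Set.Ici 0) z)
  have key := ODE_solution_unique_of_mem_Icc_right (v := fun _ x => A x) (s := fun _ => Set.univ)
    (K := ‖A‖₊) (f := y) (g := fun r => U r z) (a := 0) (b := t)
    (fun _ _ => A.lipschitz.lipschitzOnWith) hyc.continuousOn ?_ (fun _ _ => trivial) ?_ ?_
    (fun _ _ => trivial) ?_
  · exact key ⟨ht, le_rfl⟩
  · intro r hr
    have h1 : HasDerivAt (fun t => z + ∫ s in (0 : ℝ)..t, A (y s)) (A (y r)) r :=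
      ((A.continuous.comp hyc).integral_hasStrictDerivAt 0 r).hasDerivAt.const_add z
    exact h1.hasDerivWithinAt.congr (fun s hs => hy s (hr.1.trans hs)) (hy r hr.1)
  · exact fun r hr => (hUz r hr.1).continuousWithinAt.mono fun s hs => hs.1
  · exact fun r hr => (hUz r hr.1).mono fun s hs => hr.1.trans hs
  · simp [hU0, hy 0 le_rfl]

/-- The flow of the equation with interaction consists of rigid motions: a rotation about the
centre of mass of the initial measure followed by a translation by the Wiener process. -/
theorem flow_eq {A : E3 →L[ℝ] E3} {U : ℝ → E3 →L[ℝ] E3} (hU0 : U 0 = 1)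
    (hU : ∀ t, 0 ≤ t → HasDerivWithinAt U (A * U t) (Set.Ici 0) t) {f : ℝ → E3}
    (hf : Continuous f) {x : E3 → ℝ≥0 → E3} {w : ℝ≥0 → E3}
    (hx : Continuous (fun p : E3 × ℝ≥0 => x p.1 p.2))
    (hxw : ∀ (u : E3) (t : ℝ≥0), x u t = u
      + (∫ s in (0 : ℝ)..t, A (x u s.toNNReal - ∫ v, x v s.toNNReal ∂(visitationMeasure f)))
      + w t) (u : E3) (t : ℝ≥0) :
    x u t = (∫ v, v ∂(visitationMeasure f)) + U t (u - ∫ v, v ∂(visitationMeasure f)) + w t := by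
  set μ := visitationMeasure f
  have := isProbabilityMeasure_visitationMeasure hf
  set m₀ := ∫ v, v ∂μ
  set m : ℝ → E3 := fun s => ∫ v, x v s.toNNReal ∂μ with hm
  have hxs : ∀ s, Continuous (fun v => x v s) := fun s =>
    hx.comp (Y := E3 × ℝ≥0) (continuous_id.prodMk continuous_const)
  have hxt : ∀ v, Continuous (fun s : ℝ => x v s.toNNReal) := fun v =>
    hx.comp (Y := E3 × ℝ≥0) (continuous_const.prodMk continuous_real_toNNReal)
  have hmc : Continuous m := by
    have h1 : m = fun s => (2 * Real.pi)⁻¹ •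
        ∫ r in (0 : ℝ)..(2 * Real.pi), x (f r) s.toNNReal := by
      ext1 s
      exact integral_visitationMeasure hf (hxs _)
    rw [h1]
    refine Continuous.const_smul (M := ℝ) (α := E3) ?_ _
    apply intervalIntegral.continuous_parametric_intervalIntegral_of_continuous'
    have h2 : Continuous (fun p : ℝ × ℝ => ((f p.2, p.1.toNNReal) : E3 × ℝ≥0)) :=
      (hf.comp continuous_snd).prodMk (continuous_real_toNNReal.comp continuous_fst)
    exact hx.comp h2
  have hint : ∀ v a b, IntervalIntegrable (fun s : ℝ => A (x v s.toNNReal - m s)) volume a b :=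
    fun v a b => (A.continuous.comp ((hxt v).sub hmc)).intervalIntegrable a b
  -- Both the noise and the mean cancel, leaving the homogeneous linear equation.
  have hdiff : ∀ v (s : ℝ≥0), x u s - x v s = U s (u - v) := by
    intro v s
    have h1 := eq_of_integral_eq hU0 hU (y := fun s : ℝ => x u s.toNNReal - x v s.toNNReal)
      (z := u - v) ((hxt u).sub (hxt v)) ?_ s.2
    · simpa using h1
    · intro r hr
      lift r to ℝ≥0 using hr
      simp only [Real.toNNReal_coe]
      rw [hxw u r, hxw v r]
      have h2 : ∀ s : ℝ, A (x u s.toNNReal - x v s.toNNReal) =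
          A (x u s.toNNReal - m s) - A (x v s.toNNReal - m s) := fun s => by
        rw [← map_sub, sub_sub_sub_cancel_right]
      simp_rw [h2]
      rw [intervalIntegral.integral_sub (hint _ _ _) (hint _ _ _)]
      abel
  -- Average `hdiff` over v. The drift is then explicit, being the derivative of `U s (u - m₀)`.
  have hmean : ∀ s : ℝ≥0, x u s - m s = U s (u - m₀) := by
    intro s
    have h1 : m s = ∫ v, (x u s - U s (u - v)) ∂μ := by
      simp only [hm, Real.toNNReal_coe]
      refine integral_congr_ae (Filter.Eventually.of_forall fun v => ?_)
      simp only [← hdiff, sub_sub_cancel]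
    have hi : Integrable (fun v : E3 => v) μ := integrable_visitationMeasure hf continuous_id
    have hi' : Integrable (fun v : E3 => u - v) μ := (integrable_const u).sub hi
    rw [h1, integral_sub (integrable_const _) ((U s).integrable_comp hi'),
      (U s).integral_comp_comm hi',
      integral_sub (integrable_const _) hi]
    simp [m₀]
  have hFTC : ∫ s in (0 : ℝ)..t, A (x u s.toNNReal - m s) = U t (u - m₀) - (u - m₀) := by
    have hd : ∀ r, 0 ≤ r →
        HasDerivWithinAt (fun r => U r (u - m₀)) (A (U r (u - m₀))) (Set.Ici 0) r :=
      fun r hr => by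
        simpa using (hU r hr).clm_apply (hasDerivWithinAt_const r (Set.Ici 0) (u - m₀))
    have h0 : U t (u - m₀) - (u - m₀) = U t (u - m₀) - U (0 : ℝ) (u - m₀) := by simp [hU0]
    rw [h0]
    refine intervalIntegral.integral_eq_sub_of_hasDeriv_right_of_le
      (f := fun r => U r (u - m₀)) t.2 ?_ ?_ (hint _ _ _)
    · exact fun r hr => (hd r hr.1).continuousWithinAt.mono fun s hs => hs.1
    · intro r hr
      have h3 := hmean r.toNNReal
      rw [Real.coe_toNNReal r hr.1.le] at h3
      rw [h3]
      exact (hd r hr.1.le).mono fun s hs => hr.1.le.trans (le_of_lt hs)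
  rw [hxw u t, hFTC]
  abel

end RandomKnot

/-! ### C¹ approximation and C¹-closed algebras of periodic functions. -/

namespace RandomKnot

theorem exists_polynomial_derivative_eq (q : Polynomial ℝ) :
    ∃ p : Polynomial ℝ, Polynomial.derivative p = q := by
  induction q using Polynomial.induction_on' with
  | add p q hp hq =>
    obtain ⟨p', rfl⟩ := hp
    obtain ⟨q', rfl⟩ := hq
    exact ⟨p' + q', by simp⟩
  | monomial n a =>
    refine ⟨Polynomial.monomial (n + 1) (a / (n + 1)), ?_⟩
    rw [Polynomial.derivative_monomial]
    have : (n : ℝ) + 1 ≠ 0 := by positivity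
    simp [this]

/-- The Weierstrass theorem in the `C¹` norm. -/
theorem exists_polynomial_near_deriv {a b : ℝ} {φ φ' : ℝ → ℝ}
    (hφ : ∀ x ∈ Set.Icc a b, HasDerivAt φ (φ' x) x) (hφ' : ContinuousOn φ' (Set.Icc a b))
    {ε : ℝ} (hε : 0 < ε) : ∃ p : Polynomial ℝ, ∀ x ∈ Set.Icc a b,
      |p.eval x - φ x| ≤ ε ∧ |(Polynomial.derivative p).eval x - φ' x| ≤ ε := by
  by_cases hab : a ≤ b
  swap
  · exact ⟨0, fun x hx => absurd (hx.1.trans hx.2) hab⟩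
  have h1 : 0 < 1 + (b - a) := by linarith
  -- Approximate the derivative and integrate: the length b - a absorbs the integrated error, and
  -- the 1 keeps the derivative error itself below ε.
  obtain ⟨q, hq⟩ := exists_polynomial_near_of_continuousOn a b φ' hφ' (ε / (1 + (b - a)))
    (by positivity)
  obtain ⟨p, rfl⟩ := exists_polynomial_derivative_eq q
  refine ⟨p + Polynomial.C (φ a - p.eval a), fun x hx => ?_⟩
  have h2 : ε / (1 + (b - a)) ≤ ε := div_le_self hε.le (by linarith)
  constructor
  · have h3 := (convex_Icc a b).norm_image_sub_le_of_norm_hasDerivWithin_le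
      (f := fun x => p.eval x - φ x) (f' := fun x => (Polynomial.derivative p).eval x - φ' x)
      (fun y hy => ((p.hasDerivAt y).sub (hφ y hy)).hasDerivWithinAt)
      (fun y hy => (hq y hy).le) (Set.left_mem_Icc.2 hab) hx
    rw [Real.norm_eq_abs, Real.norm_eq_abs, abs_of_nonneg (sub_nonneg.2 hx.1)] at h3
    rw [Polynomial.eval_add, Polynomial.eval_C]
    calc |p.eval x + (φ a - p.eval a) - φ x| = |p.eval x - φ x - (p.eval a - φ a)| := by
          congr 1; ring
      _ ≤ ε / (1 + (b - a)) * (x - a) := h3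
      _ ≤ ε / (1 + (b - a)) * (1 + (b - a)) := by
          have := hx.2
          gcongr
          linarith
      _ = ε := by field_simp
  · simpa using (hq x hx).le.trans h2

/-- On an interval where `L' > 0` every `C¹` function factors through `L` by a `C¹` function. -/
theorem exists_contDiff_comp_eq {L g : ℝ → ℝ} (hL : ContDiff ℝ 1 L) (hg : ContDiff ℝ 1 g)
    {a b : ℝ} (hab : a ≤ b) (hpos : ∀ s ∈ Set.Icc a b, 0 < deriv L s) :
    ∃ ψ : ℝ → ℝ, ContDiff ℝ 1 ψ ∧ ∀ s ∈ Set.Icc a b, ψ (L s) = g s := by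
  have hL' : Continuous (deriv L) := hL.continuous_deriv le_rfl
  -- Freezing the derivative at its endpoint values outside the interval extends `L` to a C¹
  -- diffeomorphism `M` of the line, whose inverse is globally C¹.
  let D : ℝ → ℝ := fun r => deriv L (Set.projIcc a b hab r)
  have hD : Continuous D := hL'.comp (continuous_subtype_val.comp continuous_projIcc)
  obtain ⟨m, hm, hmD⟩ := isCompact_Icc.exists_forall_le' hL'.continuousOn hpos
  have hmD' : ∀ r, m ≤ D r := fun r => hmD _ (Set.projIcc a b hab r).2
  let M : ℝ → ℝ := fun s => L a + ∫ r in a..s, D r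
  have hM : ∀ s, HasDerivAt M (D s) s := fun s =>
    (hD.integral_hasStrictDerivAt a s).hasDerivAt.const_add (L a)
  have hMmono : StrictMono M := strictMono_of_hasDerivAt_pos hM fun s => hm.trans_le (hmD' s)
  have hMcont : Continuous M := continuous_iff_continuousAt.2 fun s => (hM s).continuousAt
  have hMlow : ∀ x y, x ≤ y → m * (y - x) ≤ M y - M x := by
    have : Monotone fun s => M s - m * s := by
      refine monotone_of_deriv_nonneg
        (fun s => ((hM s).sub ((hasDerivAt_id s).const_mul m)).differentiableAt) fun s => ?_
      have h := ((hM s).sub ((hasDerivAt_id s).const_mul m)).deriv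
      simp only [Pi.sub_def, id] at h
      rw [h]
      have := hmD' s
      linarith
    intro x y hxy
    have := this hxy
    simp only at this
    linarith
  have hMsurj : Function.Surjective M := by
    refine hMcont.surjective ?_ ?_
    · refine Filter.tendsto_atTop_mono' _ (f₁ := fun y => M 0 + m * y) ?_
        (Filter.tendsto_atTop_add_const_left _ _ (Filter.tendsto_id.const_mul_atTop hm))
      filter_upwards [Filter.eventually_ge_atTop 0] with y hy
      have := hMlow 0 y hy
      linarith
    · refine Filter.tendsto_atBot_mono' _ (f₁ := fun y => M 0 + m * y) ?_
        (Filter.tendsto_atBot_add_const_left _ _ (Filter.tendsto_id.const_mul_atBot hm))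
      filter_upwards [Filter.eventually_le_atBot 0] with y hy
      have := hMlow y 0 hy
      linarith
  let e : ℝ ≃o ℝ := hMmono.orderIsoOfSurjective M hMsurj
  have heM : ∀ s, e s = M s := fun s => rfl
  have hN : ∀ y, HasDerivAt e.symm (D (e.symm y))⁻¹ y := fun y =>
    HasDerivAt.of_local_left_inverse e.symm.continuous.continuousAt (hM (e.symm y))
      (hm.trans_le (hmD' _)).ne' (Filter.Eventually.of_forall fun z => by
        rw [← heM, e.apply_symm_apply])
  have hNc : ContDiff ℝ 1 e.symm := by
    rw [contDiff_one_iff_deriv]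
    refine ⟨fun y => (hN y).differentiableAt, ?_⟩
    rw [show deriv e.symm = fun y => (D (e.symm y))⁻¹ from funext fun y => (hN y).deriv]
    exact (hD.comp e.symm.continuous).inv₀ fun y => (hm.trans_le (hmD' _)).ne'
  refine ⟨g ∘ e.symm, hg.comp hNc, fun s hs => ?_⟩
  have hMs : M s = L s := by
    have h1 : ∫ r in a..s, D r = ∫ r in a..s, deriv L r := by
      refine intervalIntegral.integral_congr fun r hr => ?_
      rw [Set.uIcc_of_le hs.1] at hr
      simp only [D, Set.projIcc_of_mem hab ⟨hr.1, hr.2.trans hs.2⟩]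
    have h2 : ∫ r in a..s, deriv L r = L s - L a :=
      intervalIntegral.integral_deriv_eq_sub (fun r _ => hL.differentiable one_ne_zero r)
        (hL'.intervalIntegrable _ _)
    simp only [M, h1, h2]
    ring
  rw [Function.comp_apply, ← hMs, ← heM, e.symm_apply_apply]

variable {ι : Type*}

/-- Families of continuously differentiable `2π`-periodic functions. -/
def c1Periodic (ι : Type*) : Subalgebra ℝ (ι → ℝ → ℝ) where
  carrier := {f | ∀ j, ContDiff ℝ 1 (f j) ∧ Function.Periodic (f j) (2 * Real.pi)}
  mul_mem' hf hg j := ⟨(hf j).1.mul (hg j).1, (hf j).2.mul (hg j).2⟩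
  add_mem' hf hg j := ⟨(hf j).1.add (hg j).1, (hf j).2.add (hg j).2⟩
  algebraMap_mem' _ _ := ⟨contDiff_const, fun _ => rfl⟩

theorem hasDerivAt_of_mem_c1Periodic {f : ι → ℝ → ℝ} (hf : f ∈ c1Periodic ι) (j : ι) (s : ℝ) :
    HasDerivAt (f j) (deriv (f j) s) s :=
  ((hf j).1.differentiable one_ne_zero s).hasDerivAt

theorem continuous_deriv_of_mem_c1Periodic {f : ι → ℝ → ℝ} (hf : f ∈ c1Periodic ι) (j : ι) :
    Continuous (deriv (f j)) :=
  (hf j).1.continuous_deriv le_rfl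

theorem exists_bound_of_mem_c1Periodic [Finite ι] {f : ι → ℝ → ℝ} (hf : f ∈ c1Periodic ι) :
    ∃ C, 0 < C ∧ ∀ j s, |f j s| ≤ C ∧ |deriv (f j) s| ≤ C := by
  have key : ∀ g : ℝ → ℝ, Continuous g → Function.Periodic g (2 * Real.pi) →
      ∃ C, ∀ s, |g s| ≤ C := by
    intro g hg hp
    obtain ⟨C, hC⟩ := (isCompact_Icc (a := (0 : ℝ)) (b := 2 * Real.pi)).exists_bound_of_continuousOn
      hg.continuousOn
    refine ⟨C, fun s => ?_⟩
    obtain ⟨y, hy, hys⟩ := hp.exists_mem_Ico₀ Real.two_pi_pos s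
    rw [hys]
    exact hC y (Set.Ico_subset_Icc_self hy)
  have hdp : ∀ j, Function.Periodic (deriv (f j)) (2 * Real.pi) := fun j s => by
    rw [← deriv_comp_add_const]
    congr 1
    exact funext (hf j).2
  choose C₁ hC₁ using fun j => key (f j) (hf j).1.continuous (hf j).2
  choose C₂ hC₂ using fun j => key _ (continuous_deriv_of_mem_c1Periodic hf j) (hdp j)
  obtain ⟨M₁, hM₁⟩ := (Set.finite_range C₁).bddAbove
  obtain ⟨M₂, hM₂⟩ := (Set.finite_range C₂).bddAbove
  refine ⟨max (max M₁ M₂) 1, by positivity, fun j s => ⟨?_, ?_⟩⟩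
  · exact ((hC₁ j s).trans (hM₁ ⟨j, rfl⟩)).trans ((le_max_left _ _).trans (le_max_left _ _))
  · exact ((hC₂ j s).trans (hM₂ ⟨j, rfl⟩)).trans ((le_max_right _ _).trans (le_max_left _ _))

/-- Uniform `ε`-closeness of two families together with their derivatives. -/
def C1Close (ε : ℝ) (f g : ι → ℝ → ℝ) : Prop :=
  ∀ j s, |f j s - g j s| ≤ ε ∧ |deriv (f j) s - deriv (g j) s| ≤ ε

theorem C1Close.trans {ε δ : ℝ} {f g h : ι → ℝ → ℝ} (hfg : C1Close ε f g) (hgh : C1Close δ g h) :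
    C1Close (ε + δ) f h := fun j s =>
  ⟨(abs_sub_le _ _ _).trans (add_le_add (hfg j s).1 (hgh j s).1),
    (abs_sub_le _ _ _).trans (add_le_add (hfg j s).2 (hgh j s).2)⟩

theorem abs_mul_sub_mul_le {F G f g δ C : ℝ} (hF : |F - f| ≤ δ) (hG : |G - g| ≤ δ) (hf : |f| ≤ C)
    (hg : |g| ≤ C) (hδ : δ ≤ 1) : |F * G - f * g| ≤ δ * (2 * C + 1) := by
  have hG' : |G| ≤ C + 1 := by
    have := abs_sub_abs_le_abs_sub G g
    linarith
  have hδ0 : 0 ≤ δ := (abs_nonneg _).trans hF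
  calc |F * G - f * g| = |(F - f) * G + f * (G - g)| := by congr 1; ring
    _ ≤ |(F - f) * G| + |f * (G - g)| := abs_add_le _ _
    _ = |F - f| * |G| + |f| * |G - g| := by rw [abs_mul, abs_mul]
    _ ≤ δ * (C + 1) + C * δ := by
        gcongr
        exact (abs_nonneg _).trans hf
    _ = _ := by ring

theorem C1Close.mul {F G f g : ι → ℝ → ℝ} {δ C : ℝ} (hF : C1Close δ F f) (hG : C1Close δ G g)
    (hFp : F ∈ c1Periodic ι) (hGp : G ∈ c1Periodic ι) (hfp : f ∈ c1Periodic ι)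
    (hgp : g ∈ c1Periodic ι) (hf : ∀ j s, |f j s| ≤ C ∧ |deriv (f j) s| ≤ C)
    (hg : ∀ j s, |g j s| ≤ C ∧ |deriv (g j) s| ≤ C) (hδ : δ ≤ 1) :
    C1Close (2 * (δ * (2 * C + 1))) (F * G) (f * g) := by
  intro j s
  have h1 := abs_mul_sub_mul_le (hF j s).1 (hG j s).1 (hf j s).1 (hg j s).1 hδ
  refine ⟨h1.trans (by linarith [(abs_nonneg _).trans h1]), ?_⟩
  have e1 := ((hasDerivAt_of_mem_c1Periodic hFp j s).mul
    (hasDerivAt_of_mem_c1Periodic hGp j s)).deriv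
  have e2 := ((hasDerivAt_of_mem_c1Periodic hfp j s).mul
    (hasDerivAt_of_mem_c1Periodic hgp j s)).deriv
  have h2 := abs_mul_sub_mul_le (hF j s).2 (hG j s).1 (hf j s).2 (hg j s).1 hδ
  have h3 := abs_mul_sub_mul_le (hF j s).1 (hG j s).2 (hf j s).1 (hg j s).2 hδ
  rw [Pi.mul_apply, Pi.mul_apply, e1, e2, add_sub_add_comm]
  exact (abs_add_le _ _).trans (by linarith)

theorem C1Close.add {F G f g : ι → ℝ → ℝ} {δ ε : ℝ} (hF : C1Close δ F f) (hG : C1Close ε G g)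
    (hFp : F ∈ c1Periodic ι) (hGp : G ∈ c1Periodic ι) (hfp : f ∈ c1Periodic ι)
    (hgp : g ∈ c1Periodic ι) : C1Close (δ + ε) (F + G) (f + g) := by
  intro j s
  have e1 := ((hasDerivAt_of_mem_c1Periodic hFp j s).add
    (hasDerivAt_of_mem_c1Periodic hGp j s)).deriv
  have e2 := ((hasDerivAt_of_mem_c1Periodic hfp j s).add
    (hasDerivAt_of_mem_c1Periodic hgp j s)).deriv
  rw [Pi.add_apply F, Pi.add_apply f, e1, e2, Pi.add_apply, Pi.add_apply, add_sub_add_comm,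
    add_sub_add_comm]
  exact ⟨(abs_add_le _ _).trans (add_le_add (hF j s).1 (hG j s).1),
    (abs_add_le _ _).trans (add_le_add (hF j s).2 (hG j s).2)⟩

/-- The closure of an algebra of periodic functions in the `C¹` norm. -/
def c1Closure [Finite ι] (𝒜 : Subalgebra ℝ (ι → ℝ → ℝ)) (h𝒜 : 𝒜 ≤ c1Periodic ι) :
    Subalgebra ℝ (ι → ℝ → ℝ) where
  carrier := {f | f ∈ c1Periodic ι ∧ ∀ ε > 0, ∃ F ∈ 𝒜, C1Close ε F f}
  mul_mem' := by
    rintro f g ⟨hf, hf'⟩ ⟨hg, hg'⟩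
    refine ⟨mul_mem hf hg, fun ε hε => ?_⟩
    obtain ⟨C₁, hC₁, hfC⟩ := exists_bound_of_mem_c1Periodic hf
    obtain ⟨C₂, hC₂, hgC⟩ := exists_bound_of_mem_c1Periodic hg
    set C := max C₁ C₂
    have hC : 0 < C := lt_max_of_lt_left hC₁
    set δ := min 1 (ε / (2 * (2 * C + 1))) with hδ
    have hδ0 : 0 < δ := by positivity
    obtain ⟨F, hF, hFf⟩ := hf' δ hδ0
    obtain ⟨G, hG, hGg⟩ := hg' δ hδ0
    refine ⟨F * G, mul_mem hF hG, fun j s => ?_⟩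
    have h := hFf.mul hGg (h𝒜 hF) (h𝒜 hG) hf hg (C := C)
      (fun j s => ⟨(hfC j s).1.trans (le_max_left _ _), (hfC j s).2.trans (le_max_left _ _)⟩)
      (fun j s => ⟨(hgC j s).1.trans (le_max_right _ _), (hgC j s).2.trans (le_max_right _ _)⟩)
      (min_le_left _ _) j s
    have hle : 2 * (δ * (2 * C + 1)) ≤ ε := by
      have : δ ≤ ε / (2 * (2 * C + 1)) := min_le_right _ _
      rw [le_div_iff₀ (by positivity)] at this
      linarith
    exact ⟨h.1.trans hle, h.2.trans hle⟩
  add_mem' := by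
    rintro f g ⟨hf, hf'⟩ ⟨hg, hg'⟩
    refine ⟨add_mem hf hg, fun ε hε => ?_⟩
    obtain ⟨F, hF, hFf⟩ := hf' (ε / 2) (by positivity)
    obtain ⟨G, hG, hGg⟩ := hg' (ε / 2) (by positivity)
    refine ⟨F + G, add_mem hF hG, ?_⟩
    have := hFf.add hGg (h𝒜 hF) (h𝒜 hG) hf hg
    rwa [add_halves] at this
  algebraMap_mem' r := ⟨Subalgebra.algebraMap_mem _ r, fun ε hε =>
    ⟨_, Subalgebra.algebraMap_mem _ r, fun j s => by simp [hε.le]⟩⟩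

theorem comp_mem_c1Periodic {f : ι → ℝ → ℝ} (hf : f ∈ c1Periodic ι) {a b : ℝ} {φ φ' : ℝ → ℝ}
    (hab : ∀ j s, f j s ∈ Set.Icc a b) (hφ : ∀ x ∈ Set.Icc a b, HasDerivAt φ (φ' x) x)
    (hφ' : ContinuousOn φ' (Set.Icc a b)) : (fun j s => φ (f j s)) ∈ c1Periodic ι := by
  intro j
  have hd : ∀ s, HasDerivAt (fun s => φ (f j s)) (φ' (f j s) * deriv (f j) s) s := fun s =>
    (hφ _ (hab j s)).comp s (hasDerivAt_of_mem_c1Periodic hf j s)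
  refine ⟨contDiff_one_iff_deriv.2 ⟨fun s => (hd s).differentiableAt, ?_⟩, fun s => ?_⟩
  · rw [funext fun s => (hd s).deriv]
    exact (hφ'.comp_continuous (hf j).1.continuous (hab j)).mul
      (continuous_deriv_of_mem_c1Periodic hf j)
  · simp only [(hf j).2 s]

section Closure

variable [Finite ι] {𝒜 : Subalgebra ℝ (ι → ℝ → ℝ)} {h𝒜 : 𝒜 ≤ c1Periodic ι}

theorem mem_c1Periodic_of_mem_c1Closure {f : ι → ℝ → ℝ} (hf : f ∈ c1Closure 𝒜 h𝒜) :
    f ∈ c1Periodic ι := hf.1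

theorem subset_c1Closure {f : ι → ℝ → ℝ} (hf : f ∈ 𝒜) : f ∈ c1Closure 𝒜 h𝒜 :=
  ⟨h𝒜 hf, fun ε hε => ⟨f, hf, fun j s => by simp [hε.le]⟩⟩

theorem mem_c1Closure_of_close {f : ι → ℝ → ℝ} (hf : f ∈ c1Periodic ι)
    (h : ∀ ε > 0, ∃ F ∈ c1Closure 𝒜 h𝒜, C1Close ε F f) : f ∈ c1Closure 𝒜 h𝒜 := by
  refine ⟨hf, fun ε hε => ?_⟩
  obtain ⟨F, hF, hFf⟩ := h (ε / 2) (by positivity)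
  obtain ⟨G, hG, hGF⟩ := hF.2 (ε / 2) (by positivity)
  have := hGF.trans hFf
  rw [add_halves] at this
  exact ⟨G, hG, this⟩

/-- The closure is stable under composition with `C¹` functions. -/
theorem comp_mem_c1Closure {f : ι → ℝ → ℝ} (hf : f ∈ c1Closure 𝒜 h𝒜) {a b : ℝ} {φ φ' : ℝ → ℝ}
    (hab : ∀ j s, f j s ∈ Set.Icc a b) (hφ : ∀ x ∈ Set.Icc a b, HasDerivAt φ (φ' x) x)
    (hφ' : ContinuousOn φ' (Set.Icc a b)) : (fun j s => φ (f j s)) ∈ c1Closure 𝒜 h𝒜 := by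
  have hfp := mem_c1Periodic_of_mem_c1Closure hf
  refine mem_c1Closure_of_close (comp_mem_c1Periodic hfp hab hφ hφ') fun ε hε => ?_
  obtain ⟨C, hC, hfC⟩ := exists_bound_of_mem_c1Periodic hfp
  -- The chain rule multiplies the derivative error by |f'| ≤ C.
  obtain ⟨p, hp⟩ := exists_polynomial_near_deriv hφ hφ' (ε := min ε (ε / C)) (by positivity)
  have hpe : Polynomial.aeval f p = fun j s => p.eval (f j s) := by
    ext j s
    clear hp
    induction p using Polynomial.induction_on' with
    | add p q hp hq => simp_all
    | monomial n a => simp [Polynomial.aeval_monomial]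
  refine ⟨fun j s => p.eval (f j s), ?_, fun j s => ⟨?_, ?_⟩⟩
  · rw [← hpe]
    exact Algebra.adjoin_le (Set.singleton_subset_iff.2 hf)
      (Polynomial.aeval_mem_adjoin_singleton ℝ f)
  · exact ((hp _ (hab j s)).1).trans (min_le_left _ _)
  · have h1 : HasDerivAt (fun s => p.eval (f j s))
        ((Polynomial.derivative p).eval (f j s) * deriv (f j) s) s :=
      (p.hasDerivAt (f j s)).comp s (hasDerivAt_of_mem_c1Periodic hfp j s)
    have h2 : HasDerivAt (fun s => φ (f j s)) (φ' (f j s) * deriv (f j) s) s :=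
      (hφ _ (hab j s)).comp s (hasDerivAt_of_mem_c1Periodic hfp j s)
    rw [h1.deriv, h2.deriv, ← sub_mul, abs_mul]
    calc _ ≤ ε / C * C := by
          gcongr
          · exact (hp _ (hab j s)).2.trans (min_le_right _ _)
          · exact (hfC j s).2
      _ = ε := by field_simp

theorem comp_mem_c1Closure_of_contDiff {f : ι → ℝ → ℝ} (hf : f ∈ c1Closure 𝒜 h𝒜) {φ : ℝ → ℝ}
    (hφ : ContDiff ℝ 1 φ) : (fun j s => φ (f j s)) ∈ c1Closure 𝒜 h𝒜 := by
  obtain ⟨C, hC, hfC⟩ := exists_bound_of_mem_c1Periodic (mem_c1Periodic_of_mem_c1Closure hf)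
  exact comp_mem_c1Closure hf (fun j s => abs_le.1 (hfC j s).1)
    (fun x _ => (hφ.differentiable one_ne_zero x).hasDerivAt)
    (hφ.continuous_deriv le_rfl).continuousOn

end Closure

end RandomKnot

/-! ### C¹ density on links: local coordinates, partition of unity, Gaussian kernels. -/

namespace RandomKnot

variable {ι : Type*}

/-- A family of pairwise disjoint knots. -/
structure IsLink (γ : ι → ℝ → E3) : Prop where
  isKnot : ∀ j, IsKnot (γ j)
  disjoint : ∀ j k s s', γ j s = γ k s' → j = k

section Link

variable [Finite ι] {𝒜 : Subalgebra ℝ (ι → ℝ → ℝ)} {h𝒜 : 𝒜 ≤ c1Periodic ι} {γ : ι → ℝ → E3}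

theorem inner_mem_c1Closure (hc : ∀ i : Fin 3, (fun j s => γ j s i) ∈ c1Closure 𝒜 h𝒜) (e : E3) :
    (fun j s => inner ℝ (γ j s) e) ∈ c1Closure 𝒜 h𝒜 := by
  have : (fun j s => inner ℝ (γ j s) e) = ∑ i : Fin 3, e i • fun j s => γ j s i := by
    ext j s
    simp [PiLp.inner_apply, Fin.sum_univ_three]
  rw [this]
  exact sum_mem fun i _ => Subalgebra.smul_mem _ (hc i) _

theorem normSq_sub_mem_c1Closure (hc : ∀ i : Fin 3, (fun j s => γ j s i) ∈ c1Closure 𝒜 h𝒜)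
    (x : E3) : (fun j s => ‖γ j s - x‖ ^ 2) ∈ c1Closure 𝒜 h𝒜 := by
  have : (fun j s => ‖γ j s - x‖ ^ 2) =
      ∑ i : Fin 3, ((fun j s => γ j s i) - algebraMap ℝ (ι → ℝ → ℝ) (x i)) ^ 2 := by
    ext j s
    simp [EuclideanSpace.real_norm_sq_eq, Fin.sum_univ_three]
  rw [this]
  exact sum_mem fun i _ => pow_mem (sub_mem (hc i) (Subalgebra.algebraMap_mem _ _)) _

/-- The point is hit only at the parameter s₀ modulo 2π of its own component. Away from
neighbourhoods of these parameters, compactness bounds the distance to it from below. -/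
theorem IsLink.exists_separating (hγ : IsLink γ) (j₀ : ι) (s₀ : ℝ) {η : ℝ} (hη : 0 < η) :
    ∃ δ > 0, ∀ j s, ‖γ j s - γ j₀ s₀‖ ^ 2 < δ →
      j = j₀ ∧ ∃ n : ℤ, |s - n * (2 * Real.pi) - s₀| < η := by
  let N : ι → Set ℝ := fun j => {s | j = j₀ ∧ ∃ n : ℤ, |s - n * (2 * Real.pi) - s₀| < η}
  have hN : ∀ j, IsOpen (N j) := by
    intro j
    by_cases hj : j = j₀
    · have : N j = ⋃ n : ℤ, {s | |s - n * (2 * Real.pi) - s₀| < η} := by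
        ext s
        simp [N, hj]
      rw [this]
      exact isOpen_iUnion fun n => isOpen_lt (by fun_prop) continuous_const
    · have : N j = ∅ := by
        ext s
        simp [N, hj]
      rw [this]
      exact isOpen_empty
  have hpos : ∀ j, ∃ δ > 0, ∀ s ∈ Set.Icc 0 (2 * Real.pi) \ N j, δ ≤ ‖γ j s - γ j₀ s₀‖ ^ 2 := by
    intro j
    refine (isCompact_Icc.diff (hN j)).exists_forall_le' ?_ fun s hs => ?_
    · have := (hγ.isKnot j).contDiff.continuous
      fun_prop
    · have hne : γ j s ≠ γ j₀ s₀ := by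
        intro heq
        have hj := hγ.disjoint _ _ _ _ heq
        subst hj
        obtain ⟨n, hn⟩ := (hγ.isKnot j).exists_int_of_eq heq
        exact hs.2 ⟨rfl, n, by rw [sub_right_comm, hn]; simpa using hη⟩
      have := norm_pos_iff.2 (sub_ne_zero.2 hne)
      positivity
  choose δ hδ hδN using hpos
  have : Nonempty ι := ⟨j₀⟩
  obtain ⟨k, hk⟩ := Finite.exists_min δ
  refine ⟨δ k, hδ k, fun j s hs => ?_⟩
  set n := toIcoDiv Real.two_pi_pos 0 s
  have hmem : s - n * (2 * Real.pi) ∈ Set.Icc 0 (2 * Real.pi) := by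
    have := toIcoMod_mem_Ico Real.two_pi_pos 0 s
    rw [toIcoMod, zsmul_eq_mul, zero_add] at this
    exact Set.Ico_subset_Icc_self this
  have hper : γ j (s - n * (2 * Real.pi)) = γ j s := (hγ.isKnot j).periodic.sub_int_mul_eq n
  have hin : s - n * (2 * Real.pi) ∈ N j := by
    by_contra hnot
    have h1 := hδN j _ ⟨hmem, hnot⟩
    rw [hper] at h1
    exact absurd hs (not_lt.2 ((hk j).trans h1))
  obtain ⟨hj, m, hm⟩ := hin
  refine ⟨hj, n + m, ?_⟩
  push_cast
  convert hm using 2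
  ring

/-- Localization. Height along the tangent at the point is a local C¹ coordinate, so on a short arc
every g is a C¹ function ψ of the height, and ψ of the height lies in the closure. The cutoff β is a
smooth function of squared distance, so it lies there too, and it vanishes off the translates of the
arc. -/
theorem IsLink.exists_bump (hγ : IsLink γ)
    (hc : ∀ i : Fin 3, (fun j s => γ j s i) ∈ c1Closure 𝒜 h𝒜) (j₀ : ι) (s₀ : ℝ) :
    ∃ β ∈ c1Closure 𝒜 h𝒜, (∀ j s, 0 ≤ β j s) ∧ 0 < β j₀ s₀ ∧
      ∀ g ∈ c1Periodic ι, β * g ∈ c1Closure 𝒜 h𝒜 := by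
  set e := deriv (γ j₀) s₀ with he
  set l : ι → ℝ → ℝ := fun j s => inner ℝ (γ j s) e with hl
  have hlc : l ∈ c1Closure 𝒜 h𝒜 := inner_mem_c1Closure hc e
  have hlp := mem_c1Periodic_of_mem_c1Closure hlc
  have hl' : deriv (l j₀) s₀ = ‖e‖ ^ 2 := by
    have h1 : HasDerivAt (γ j₀) e s₀ :=
      ((hγ.isKnot j₀).contDiff.differentiable two_ne_zero s₀).hasDerivAt
    have h2 := (h1.inner ℝ (hasDerivAt_const s₀ e)).deriv
    simp only [inner_zero_right, zero_add, real_inner_self_eq_norm_sq] at h2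
    exact h2
  have hl'pos : 0 < deriv (l j₀) s₀ := by
    have : 0 < ‖e‖ := norm_pos_iff.2 ((hγ.isKnot j₀).deriv_ne_zero s₀)
    rw [hl']
    positivity
  obtain ⟨η, hη, hηpos⟩ := Metric.eventually_nhds_iff.1
    ((continuous_deriv_of_mem_c1Periodic hlp j₀).continuousAt.eventually_const_lt hl'pos)
  obtain ⟨δ, hδ, hsep⟩ := hγ.exists_separating j₀ s₀ (half_pos hη)
  set β : ι → ℝ → ℝ := fun j s => Real.smoothTransition (δ - ‖γ j s - γ j₀ s₀‖ ^ 2) with hβ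
  have hβc : β ∈ c1Closure 𝒜 h𝒜 :=
    comp_mem_c1Closure_of_contDiff (φ := fun r => Real.smoothTransition (δ - r))
      (normSq_sub_mem_c1Closure hc (γ j₀ s₀))
      (Real.smoothTransition.contDiff.comp (contDiff_const.sub contDiff_id))
  refine ⟨β, hβc, fun j s => Real.smoothTransition.nonneg _, ?_, fun g hg => ?_⟩
  · exact Real.smoothTransition.pos_of_pos (by simpa using hδ)
  · obtain ⟨ψ, hψ, hψg⟩ := exists_contDiff_comp_eq (hlp j₀).1 (hg j₀).1
      (a := s₀ - η / 2) (b := s₀ + η / 2) (by linarith) (fun s hs => hηpos (by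
        rw [Real.dist_eq, abs_lt]
        constructor <;> linarith [hs.1, hs.2]))
    have heq : β * g = β * fun j s => ψ (l j s) := by
      ext j s
      simp only [Pi.mul_apply]
      by_cases hs : ‖γ j s - γ j₀ s₀‖ ^ 2 < δ
      · obtain ⟨rfl, n, hn⟩ := hsep j s hs
        rw [← (hg j).2.sub_int_mul_eq n, ← (hlp j).2.sub_int_mul_eq n, hψg]
        rw [abs_lt] at hn
        constructor <;> linarith [hn.1, hn.2]
      · have : β j s = 0 := Real.smoothTransition.zero_of_nonpos (by linarith)
        simp [this]
    rw [heq]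
    exact mul_mem hβc (comp_mem_c1Closure_of_contDiff hlc hψ)

/-- An algebra whose `C¹` closure contains the coordinate functions of a link is `C¹` dense. -/
theorem IsLink.c1Closure_eq (hγ : IsLink γ)
    (hc : ∀ i : Fin 3, (fun j s => γ j s i) ∈ c1Closure 𝒜 h𝒜) {g : ι → ℝ → ℝ}
    (hg : g ∈ c1Periodic ι) : g ∈ c1Closure 𝒜 h𝒜 := by
  choose β hβc hβ0 hβpos hβg using fun p : ι × ℝ => hγ.exists_bump hc p.1 p.2
  have hcover : ∀ j, ∃ t : Finset ℝ, ∀ s ∈ Set.Icc 0 (2 * Real.pi),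
      ∃ r ∈ t, 0 < β (j, r) j s := by
    intro j
    obtain ⟨t, ht⟩ := (isCompact_Icc (a := (0 : ℝ)) (b := 2 * Real.pi)).elim_finite_subcover
      (fun r => {s | 0 < β (j, r) j s})
      (fun r => isOpen_lt continuous_const
        ((mem_c1Periodic_of_mem_c1Closure (hβc (j, r))) j).1.continuous)
      (fun s _ => Set.mem_iUnion.2 ⟨s, hβpos (j, s)⟩)
    refine ⟨t, fun s hs => ?_⟩
    simpa using ht hs
  choose t ht using hcover
  have := Fintype.ofFinite ι
  -- Partition of unity without normalizing: the sum of finitely many bumps is positive, so g is the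
  -- sum of the products of the bumps with g/B.
  set B : ι → ℝ → ℝ := ∑ k : ι, ∑ r ∈ t k, β (k, r) with hB
  have hBc : B ∈ c1Closure 𝒜 h𝒜 := sum_mem fun k _ => sum_mem fun r _ => hβc _
  have hBp := mem_c1Periodic_of_mem_c1Closure hBc
  have hBpos : ∀ j s, 0 < B j s := by
    intro j s
    obtain ⟨s', hs', hss⟩ := (hBp j).2.exists_mem_Ico₀ Real.two_pi_pos s
    rw [hss]
    obtain ⟨r, hr, hpos⟩ := ht j s' (Set.Ico_subset_Icc_self hs')
    simp only [hB, Finset.sum_apply]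
    refine Finset.sum_pos' (fun k _ => Finset.sum_nonneg fun r _ => hβ0 _ _ _)
      ⟨j, Finset.mem_univ j, Finset.sum_pos' (fun r _ => hβ0 _ _ _) ⟨r, hr, hpos⟩⟩
  set G : ι → ℝ → ℝ := fun j s => g j s / B j s with hG
  have hGp : G ∈ c1Periodic ι := fun j =>
    ⟨(hg j).1.div (hBp j).1 fun s => (hBpos j s).ne', (hg j).2.div (hBp j).2⟩
  have hgG : g = ∑ k : ι, ∑ r ∈ t k, β (k, r) * G := by
    simp_rw [← Finset.sum_mul]
    ext j s
    rw [Pi.mul_apply, Pi.mul_apply]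
    simp only [hG]
    rw [← hB]
    field_simp [(hBpos j s).ne']
  rw [hgG]
  exact sum_mem fun k _ => sum_mem fun r _ => hβg _ G hGp

end Link

/-- The exponential functions `x ↦ exp ⟨x, u⟩`, a multiplicative monoid. -/
def expMonoid : Submonoid (E3 → ℝ) where
  carrier := Set.range fun u : E3 => fun x => Real.exp (inner ℝ x u)
  one_mem' := ⟨0, by ext; simp⟩
  mul_mem' := by
    rintro _ _ ⟨u, rfl⟩ ⟨v, rfl⟩
    exact ⟨u + v, by ext; simp [inner_add_right, Real.exp_add]⟩

/-- The covariance kernels `x ↦ exp (-‖x - u‖²)` span the elementary part of the reproducing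
kernel space of the random field. -/
def kernelSpan : Submodule ℝ (E3 → ℝ) :=
  Submodule.span ℝ (Set.range fun u : E3 => fun x => Real.exp (-‖x - u‖ ^ 2))

theorem contDiff_of_mem_kernelSpan {F : E3 → ℝ} (hF : F ∈ kernelSpan) : ContDiff ℝ 2 F := by
  induction hF using Submodule.span_induction with
  | mem F hF =>
    obtain ⟨u, rfl⟩ := hF
    exact Real.contDiff_exp.comp ((contDiff_id.sub contDiff_const).norm_sq ℝ).neg
  | zero => exact contDiff_const
  | add F G _ _ hF hG => exact hF.add hG
  | smul a F _ hF => exact contDiff_const.smul hF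

/-- Completing the square turns a weighted exponential into a multiple of the kernel centred at u/2.
Exponentials, unlike kernels, are closed under products, which is what the algebra argument needs.
-/
theorem gaussian_mul_mem_kernelSpan {F : E3 → ℝ}
    (hF : F ∈ Algebra.adjoin ℝ (expMonoid : Set (E3 → ℝ))) :
    (fun x => Real.exp (-‖x‖ ^ 2) * F x) ∈ kernelSpan := by
  rw [← Subalgebra.mem_toSubmodule, Algebra.adjoin_eq_span, Submonoid.closure_eq] at hF
  induction hF using Submodule.span_induction with
  | mem F hF =>
    obtain ⟨u, rfl⟩ := hF
    have : (fun x : E3 => Real.exp (-‖x‖ ^ 2) * Real.exp (inner ℝ x u)) =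
        Real.exp (‖(1 / 2 : ℝ) • u‖ ^ 2) •
          fun x : E3 => Real.exp (-‖x - (1 / 2 : ℝ) • u‖ ^ 2) := by
      ext x
      rw [Pi.smul_apply, smul_eq_mul, ← Real.exp_add, ← Real.exp_add, norm_sub_sq_real,
        inner_smul_right]
      congr 1
      ring
    rw [this]
    exact Submodule.smul_mem _ _ (Submodule.subset_span ⟨_, rfl⟩)
  | zero =>
    convert Submodule.zero_mem kernelSpan using 1
    ext; simp
  | add F G _ _ hF hG =>
    convert Submodule.add_mem _ hF hG using 1
    ext; simp [mul_add]
  | smul a F _ hF =>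
    convert Submodule.smul_mem _ a hF using 1
    ext; simp [mul_left_comm]

/-- Restriction of functions to the components of a family of curves. -/
def pullback (γ : ι → ℝ → E3) : (E3 → ℝ) →ₐ[ℝ] (ι → ℝ → ℝ) where
  toFun F j s := F (γ j s)
  map_one' := rfl
  map_mul' _ _ := rfl
  map_zero' := rfl
  map_add' _ _ := rfl
  commutes' _ := rfl

theorem pullback_mem_c1Periodic {γ : ι → ℝ → E3} (hγ : ∀ j, IsKnot (γ j)) {F : E3 → ℝ}
    (hF : ContDiff ℝ 1 F) : pullback γ F ∈ c1Periodic ι := fun j =>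
  ⟨hF.comp ((hγ j).contDiff.of_le (by norm_num)), fun s => congrArg F ((hγ j).periodic s)⟩

theorem expAlgebra_le {γ : ι → ℝ → E3} (hγ : ∀ j, IsKnot (γ j)) :
    (Algebra.adjoin ℝ (expMonoid : Set (E3 → ℝ))).map (pullback γ) ≤ c1Periodic ι := by
  rw [AlgHom.map_adjoin, Algebra.adjoin_le_iff]
  rintro _ ⟨_, ⟨u, rfl⟩, rfl⟩
  exact pullback_mem_c1Periodic hγ (Real.contDiff_exp.comp (contDiff_id.inner ℝ contDiff_const))

/-- A coordinate is the logarithm of an exponential, and log is C¹ on the compact range of that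
exponential. -/
theorem coord_mem_c1Closure_expAlgebra [Finite ι] {γ : ι → ℝ → E3} (hγ : ∀ j, IsKnot (γ j))
    (i : Fin 3) : (fun j s => γ j s i) ∈ c1Closure _ (expAlgebra_le hγ) := by
  have hcoord : (fun j s => γ j s i) ∈ c1Periodic ι :=
    pullback_mem_c1Periodic hγ (F := fun x => x i) (by fun_prop)
  obtain ⟨C, hC, hb⟩ := exists_bound_of_mem_c1Periodic hcoord
  have hexp : (fun j s => Real.exp (γ j s i)) ∈ c1Closure _ (expAlgebra_le hγ) := by
    refine subset_c1Closure ⟨fun x => Real.exp (x i), Algebra.subset_adjoin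
      ⟨EuclideanSpace.single i 1, ?_⟩, rfl⟩
    ext x
    simp [EuclideanSpace.inner_single_right]
  have hlog := comp_mem_c1Closure (φ := Real.log) (φ' := fun x => x⁻¹) (a := Real.exp (-C))
    (b := Real.exp C) hexp
    (fun j s => ⟨Real.exp_le_exp.2 (abs_le.1 (hb j s).1).1,
      Real.exp_le_exp.2 (abs_le.1 (hb j s).1).2⟩)
    (fun x hx => Real.hasDerivAt_log ((Real.exp_pos _).trans_le hx.1).ne')
    (continuousOn_inv₀.mono fun x hx => ((Real.exp_pos _).trans_le hx.1).ne')
  simpa using hlog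

/-- Combinations of the covariance kernels approximate every `C¹` family on a link. -/
theorem IsLink.exists_kernelSpan_close [Finite ι] {γ : ι → ℝ → E3} (hγ : IsLink γ)
    {g : ι → ℝ → ℝ} (hg : g ∈ c1Periodic ι) {ε : ℝ} (hε : 0 < ε) :
    ∃ F ∈ kernelSpan, C1Close ε (fun j s => F (γ j s)) g := by
  have hE : ContDiff ℝ 1 fun x : E3 => Real.exp (‖x‖ ^ 2) :=
    Real.contDiff_exp.comp (contDiff_id.norm_sq ℝ)
  have hE' : ContDiff ℝ 1 fun x : E3 => Real.exp (-‖x‖ ^ 2) :=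
    Real.contDiff_exp.comp (contDiff_id.norm_sq ℝ).neg
  set ρ : ι → ℝ → ℝ := pullback γ fun x => Real.exp (-‖x‖ ^ 2) with hρ
  have hρp : ρ ∈ c1Periodic ι := pullback_mem_c1Periodic hγ.isKnot hE'
  -- Divide out the Gaussian weight, approximate by exponentials, and multiply the weight back.
  set g' : ι → ℝ → ℝ := pullback γ (fun x => Real.exp (‖x‖ ^ 2)) * g with hg'
  have hg'p : g' ∈ c1Periodic ι := mul_mem (pullback_mem_c1Periodic hγ.isKnot hE) hg
  have hgc := hγ.c1Closure_eq (coord_mem_c1Closure_expAlgebra hγ.isKnot) hg'p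
  obtain ⟨C₁, hC₁, hρC⟩ := exists_bound_of_mem_c1Periodic hρp
  obtain ⟨C₂, hC₂, hgC⟩ := exists_bound_of_mem_c1Periodic hg'p
  set C := max C₁ C₂
  have hC : 0 < C := lt_max_of_lt_left hC₁
  set δ := min 1 (ε / (2 * (2 * C + 1))) with hδ
  have hδ0 : 0 < δ := by positivity
  obtain ⟨_, ⟨F, hF, rfl⟩, hFg⟩ := hgc.2 δ hδ0
  refine ⟨fun x => Real.exp (-‖x‖ ^ 2) * F x, gaussian_mul_mem_kernelSpan hF, ?_⟩
  have hself : C1Close δ ρ ρ := fun j s => by simp [hδ0.le]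
  have h := hself.mul hFg hρp (expAlgebra_le hγ.isKnot ⟨F, hF, rfl⟩) hρp hg'p (C := C)
      (fun j s => ⟨(hρC j s).1.trans (le_max_left _ _), (hρC j s).2.trans (le_max_left _ _)⟩)
      (fun j s => ⟨(hgC j s).1.trans (le_max_right _ _), (hgC j s).2.trans (le_max_right _ _)⟩)
      (min_le_left _ _)
  have hρg : ρ * g' = g := by
    ext j s
    change Real.exp (-‖γ j s‖ ^ 2) * (Real.exp (‖γ j s‖ ^ 2) * g j s) = g j s
    rw [← mul_assoc, ← Real.exp_add]
    simp
  rw [hρg] at h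
  have hle : 2 * (δ * (2 * C + 1)) ≤ ε := by
    have : δ ≤ ε / (2 * (2 * C + 1)) := min_le_right _ _
    rw [le_div_iff₀ (by positivity)] at this
    linarith
  exact fun j s => ⟨(h j s).1.trans hle, (h j s).2.trans hle⟩

end RandomKnot

/-! ### C¹ smallness and small-ball positivity for the Gaussian field. -/

namespace RandomKnot

section LipSmall

variable {E F : Type*} [NormedAddCommGroup E] [NormedSpace ℝ E]
  [NormedAddCommGroup F] [NormedSpace ℝ F]

/-- Every set of `C¹` functions has a countable subset which is dense in the `C¹` norm on a given
compact set. -/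
theorem exists_countable_c1_dense [SecondCountableTopology E] [SecondCountableTopology F]
    [SecondCountableTopology (E →L[ℝ] F)] {𝒮 : Set (E → F)} (h𝒮 : ∀ f ∈ 𝒮, ContDiff ℝ 1 f)
    {K : Set E} (hK : IsCompact K) :
    ∃ 𝒢 ⊆ 𝒮, 𝒢.Countable ∧ ∀ f ∈ 𝒮, ∀ ε > 0, ∃ g ∈ 𝒢, ∀ x ∈ K,
      ‖f x - g x‖ ≤ ε ∧ ‖fderiv ℝ f x - fderiv ℝ g x‖ ≤ ε := by
  have : CompactSpace K := isCompact_iff_compactSpace.1 hK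
  let Θ : 𝒮 → C(K, F) × C(K, E →L[ℝ] F) := fun f =>
    (⟨fun x => f.1 x, (h𝒮 _ f.2).continuous.comp continuous_subtype_val⟩,
      ⟨fun x => fderiv ℝ f.1 x,
        ((h𝒮 _ f.2).continuous_fderiv one_ne_zero).comp continuous_subtype_val⟩)
  -- Second countability, unlike separability, passes to arbitrary subsets, so the dense sequence
  -- can be taken inside 𝒮.
  let : TopologicalSpace 𝒮 := TopologicalSpace.induced Θ inferInstance
  have := TopologicalSpace.secondCountableTopology_induced 𝒮 _ Θ
  obtain ⟨D, hDc, hD⟩ := TopologicalSpace.exists_countable_dense 𝒮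
  refine ⟨Subtype.val '' D, by rintro _ ⟨f, -, rfl⟩; exact f.2, hDc.image _, fun f hf ε hε => ?_⟩
  have hΘ : Continuous Θ := continuous_induced_dom
  obtain ⟨g, hgball, hgD⟩ := hD.inter_open_nonempty
    (Θ ⁻¹' Metric.ball (Θ ⟨f, hf⟩) ε) (Metric.isOpen_ball.preimage hΘ)
    ⟨⟨f, hf⟩, Metric.mem_ball_self hε⟩
  refine ⟨g.1, ⟨g, hgD, rfl⟩, fun x hx => ?_⟩
  have h1 : dist (Θ ⟨f, hf⟩) (Θ g) < ε := by rw [dist_comm]; exact hgball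
  rw [Prod.dist_eq, max_lt_iff] at h1
  have h2 := (ContinuousMap.dist_apply_le_dist (f := (Θ ⟨f, hf⟩).1) (g := (Θ g).1) ⟨x, hx⟩).trans
    h1.1.le
  have h3 := (ContinuousMap.dist_apply_le_dist (f := (Θ ⟨f, hf⟩).2) (g := (Θ g).2) ⟨x, hx⟩).trans
    h1.2.le
  rw [dist_eq_norm] at h2 h3
  exact ⟨h2, h3⟩

end LipSmall

section LipSmall

variable {E F : Type*} [NormedAddCommGroup E] [NormedAddCommGroup F]
  [TopologicalSpace.SeparableSpace E]

/-- On a countable dense subset of `S`, the function `a` is bounded by `ε` and `ε`-Lipschitz. -/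
def LipSmall (S : Set E) (ε : ℝ) (a : E → F) : Prop :=
  ∀ m n : ℕ, TopologicalSpace.denseSeq E m ∈ S → TopologicalSpace.denseSeq E n ∈ S →
    ‖a (TopologicalSpace.denseSeq E m)‖ ≤ ε ∧
    ‖a (TopologicalSpace.denseSeq E m) - a (TopologicalSpace.denseSeq E n)‖ ≤
      ε * ‖TopologicalSpace.denseSeq E m - TopologicalSpace.denseSeq E n‖

/-- Only countably many evaluations are involved, so the condition is visible to the product
σ-algebra carrying the law of the field. -/
theorem measurableSet_lipSmall [MeasurableSpace F] [BorelSpace F] [SecondCountableTopology F]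
    (S : Set E) (ε : ℝ) (h : E → F) : MeasurableSet {a : E → F | LipSmall S ε (a - h)} := by
  simp only [LipSmall, Set.ofPred_forall, Pi.sub_apply]
  have hm : ∀ k, Measurable fun a : E → F =>
      a (TopologicalSpace.denseSeq E k) - h (TopologicalSpace.denseSeq E k) :=
    fun k => (measurable_pi_apply _).sub_const _
  refine MeasurableSet.iInter fun m => MeasurableSet.iInter fun n => MeasurableSet.iInter fun _ =>
    MeasurableSet.iInter fun _ => MeasurableSet.inter ?_ ?_
  · exact measurableSet_le (hm m).norm measurable_const
  · exact measurableSet_le ((hm m).sub (hm n)).norm measurable_const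

theorem LipSmall.of_forall {S : Set E} {ε : ℝ} {a : E → F}
    (h : ∀ x ∈ S, ∀ y ∈ S, ‖a x‖ ≤ ε ∧ ‖a x - a y‖ ≤ ε * ‖x - y‖) : LipSmall S ε a :=
  fun _ _ hm hn => h _ hm _ hn

theorem LipSmall.forall {S : Set E} (hS : IsOpen S) {ε : ℝ} {a : E → F} (ha : Continuous a)
    (h : LipSmall S ε a) : ∀ x ∈ S, ∀ y ∈ S, ‖a x‖ ≤ ε ∧ ‖a x - a y‖ ≤ ε * ‖x - y‖ := by
  set D := S ∩ Set.range (TopologicalSpace.denseSeq E)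
  have hcl : S ⊆ closure D :=
    (TopologicalSpace.denseRange_denseSeq E).open_subset_closure_inter hS
  intro x hx y hy
  have hxy : (x, y) ∈ closure (D ×ˢ D) := by
    rw [closure_prod_eq]
    exact ⟨hcl hx, hcl hy⟩
  have hclosed : IsClosed {p : E × E | ‖a p.1‖ ≤ ε ∧ ‖a p.1 - a p.2‖ ≤ ε * ‖p.1 - p.2‖} := by
    have h1 : IsClosed {p : E × E | ‖a p.1‖ ≤ ε} := isClosed_le (by fun_prop) (by fun_prop)
    have h2 : IsClosed {p : E × E | ‖a p.1 - a p.2‖ ≤ ε * ‖p.1 - p.2‖} :=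
      isClosed_le (by fun_prop) (by fun_prop)
    exact h1.inter h2
  refine closure_minimal ?_ hclosed hxy
  rintro ⟨_, _⟩ ⟨⟨hm, m, rfl⟩, hn, n, rfl⟩
  exact h m n hm hn

theorem LipSmall.add {S : Set E} {ε δ : ℝ} {a b : E → F} (ha : LipSmall S ε a)
    (hb : LipSmall S δ b) : LipSmall S (ε + δ) (a + b) := by
  intro m n hm hn
  refine ⟨(norm_add_le _ _).trans (add_le_add (ha m n hm hn).1 (hb m n hm hn).1), ?_⟩
  rw [Pi.add_apply, Pi.add_apply, add_sub_add_comm, add_mul]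
  exact (norm_add_le _ _).trans (add_le_add (ha m n hm hn).2 (hb m n hm hn).2)

theorem LipSmall.smul [NormedSpace ℝ F] {S : Set E} {ε : ℝ} {a : E → F} (ha : LipSmall S ε a)
    (c : ℝ) :
    LipSmall S (|c| * ε) (c • a) := by
  intro m n hm hn
  rw [Pi.smul_apply, Pi.smul_apply, ← smul_sub, norm_smul, norm_smul, Real.norm_eq_abs, mul_assoc]
  exact ⟨mul_le_mul_of_nonneg_left (ha m n hm hn).1 (abs_nonneg c),
    mul_le_mul_of_nonneg_left (ha m n hm hn).2 (abs_nonneg c)⟩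

theorem LipSmall.sub [NormedSpace ℝ F] {S : Set E} {ε δ : ℝ} {a b : E → F} (ha : LipSmall S ε a)
    (hb : LipSmall S δ b) : LipSmall S (ε + δ) (a - b) := by
  have := ha.add (hb.smul (-1))
  simpa [sub_eq_add_neg] using this

theorem LipSmall.mono {S : Set E} {ε δ : ℝ} {a : E → F} (ha : LipSmall S ε a) (h : ε ≤ δ) :
    LipSmall S δ a := fun m n hm hn =>
  ⟨(ha m n hm hn).1.trans h, (ha m n hm hn).2.trans (by gcongr)⟩

theorem LipSmall.mono_set {S T : Set E} {ε : ℝ} {a : E → F} (ha : LipSmall T ε a) (h : S ⊆ T) :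
    LipSmall S ε a := fun m n hm hn => ha m n (h hm) (h hn)

theorem LipSmall.of_fderiv [NormedSpace ℝ E] [NormedSpace ℝ F] {S : Set E} (hS : Convex ℝ S)
    {ε : ℝ} {a : E → F}
    (ha : Differentiable ℝ a) (h : ∀ x ∈ S, ‖a x‖ ≤ ε ∧ ‖fderiv ℝ a x‖ ≤ ε) :
    LipSmall S ε a :=
  .of_forall fun x hx _ hy => ⟨(h x hx).1,
    hS.norm_image_sub_le_of_norm_fderiv_le (fun z _ => ha z) (fun z hz => (h z hz).2) hy hx⟩

end LipSmall

variable {Ω : Type*} [MeasurableSpace Ω] {P : Measure Ω}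

/-- Gaussian processes with the same means and covariances have the same law. -/
theorem map_eq_of_covariance_eq {T : Type*} {X Y : T → Ω → ℝ} (hX : IsGaussianProcess X P)
    (hY : IsGaussianProcess Y P) (hXm : ∀ t, Measurable (X t)) (hYm : ∀ t, Measurable (Y t))
    (hmean : ∀ t, P[X t] = P[Y t]) (hcov : ∀ s t, cov[X s, X t; P] = cov[Y s, Y t; P]) :
    P.map (fun ω t => X t ω) = P.map (fun ω t => Y t ω) := by
  have := hX.isProbabilityMeasure
  rw [map_eq_iff_forall_finset_map_restrict_eq (measurable_pi_lambda _ hXm).aemeasurable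
    (measurable_pi_lambda _ hYm).aemeasurable]
  intro I
  refine Measure.ext_of_charFunDual ?_
  ext L
  classical
  have key : ∀ Z : T → Ω → ℝ, IsGaussianProcess Z P →
      (P[fun ω => L (I.restrict (Z · ω))] = ∑ t : I, L (Pi.single t 1) * P[Z t]) ∧
      Var[fun ω => L (I.restrict (Z · ω)); P] =
        ∑ s : I, ∑ t : I, L (Pi.single s 1) * (L (Pi.single t 1) * cov[Z s, Z t; P]) := by
    intro Z hZ
    have hL : (fun ω => L (I.restrict (Z · ω))) =
        fun ω => ∑ t : I, L (Pi.single t 1) * Z t ω := by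
      ext ω
      rw [← L.sum_comp_single]
      refine Finset.sum_congr rfl fun t _ => ?_
      have : ContinuousLinearMap.single ℝ (fun _ : I => ℝ) t (I.restrict (Z · ω) t) =
          Z t ω • Pi.single t 1 := by
        ext s
        simp [ContinuousLinearMap.single_apply, Pi.single_apply]
      rw [ContinuousLinearMap.comp_apply, this, map_smul, smul_eq_mul, mul_comm]
    have hmem : ∀ t : I, MemLp (fun ω => L (Pi.single t 1) * Z t ω) 2 P := fun t =>
      (hZ.hasGaussianLaw_eval (t : T)).memLp_two.const_mul _
    rw [hL]
    constructor
    · rw [integral_finsetSum _ fun t _ => (hmem t).integrable one_le_two]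
      simp_rw [integral_const_mul]
    · rw [← covariance_self (Finset.aemeasurable_fun_sum _
          fun t _ => (hmem t).aestronglyMeasurable.aemeasurable),
        covariance_fun_sum_fun_sum hmem hmem]
      simp_rw [covariance_const_mul_left, covariance_const_mul_right]
  rw [(hX.hasGaussianLaw I).charFunDual_map_eq_fun, (hY.hasGaussianLaw I).charFunDual_map_eq_fun,
    (key X hX).1, (key X hX).2, (key Y hY).1, (key Y hY).2]
  simp_rw [hmean, hcov]

namespace IsGaussianField

variable {ξ : E3 → Ω → E3}

theorem measurable_coord (hξ : IsGaussianField ξ P) (i : Fin 3) (u : E3) :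
    Measurable (fun ω => ξ u ω i) :=
  (EuclideanSpace.proj (𝕜 := ℝ) i).continuous.measurable.comp (hξ.measurable u)

theorem measurable_path (hξ : IsGaussianField ξ P) (i : Fin 3) :
    Measurable (fun ω u => ξ u ω i) :=
  measurable_pi_lambda _ (hξ.measurable_coord i)

theorem memLp (hξ : IsGaussianField ξ P) (i : Fin 3) (u : E3) :
    MemLp (fun ω => ξ u ω i) 2 P :=
  ((hξ.gaussian i).hasGaussianLaw_eval u).memLp_two

theorem cov_eq (hξ : IsGaussianField ξ P) (i : Fin 3) (u v : E3) :
    cov[fun ω => ξ u ω i, fun ω => ξ v ω i; P] = Real.exp (-‖u - v‖ ^ 2) := by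
  have := (hξ.gaussian i).isProbabilityMeasure
  rw [covariance_eq_sub (hξ.memLp i u) (hξ.memLp i v), hξ.mean, zero_mul, sub_zero,
    ← hξ.covariance i u v]
  rfl

theorem smooth_coord (hξ : IsGaussianField ξ P) (i : Fin 3) :
    ∀ᵐ ω ∂P, ContDiff ℝ 1 (fun u => ξ u ω i) := by
  filter_upwards [hξ.smooth] with ω hω
  have h1 : ContDiff ℝ 1 (fun u => ξ u ω) := hω.of_le (by exact_mod_cast le_top)
  exact (EuclideanSpace.proj (𝕜 := ℝ) i).contDiff.comp h1

theorem map_path_eq (hξ : IsGaussianField ξ P) (i j : Fin 3) :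
    P.map (fun ω u => ξ u ω i) = P.map (fun ω u => ξ u ω j) :=
  map_eq_of_covariance_eq (hξ.gaussian i) (hξ.gaussian j) (hξ.measurable_coord i)
    (hξ.measurable_coord j) (fun t => by rw [hξ.mean, hξ.mean])
    (fun s t => by rw [hξ.cov_eq, hξ.cov_eq])

/-- A normalized difference of two independent copies has the law of one copy. This recentres
small-ball estimates: if both copies are near the same unknown function, the difference is near
zero. -/
theorem map_path_eq_sub (hξ : IsGaussianField ξ P) (i : Fin 3) :
    P.map (fun ω u => ξ u ω i) =
      P.map (fun ω u => (√2)⁻¹ * (ξ u ω 0 - ξ u ω 1)) := by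
  have := (hξ.gaussian i).isProbabilityMeasure
  have hind : IndepFun (fun ω u => ξ u ω 0) (fun ω u => ξ u ω 1) P :=
    hξ.indep.indepFun (by decide : (0 : Fin 3) ≠ 1)
  have hG : IsGaussianProcess (fun u ω => (√2)⁻¹ * (ξ u ω 0 - ξ u ω 1)) P := by
    constructor
    intro I
    have h1 : IndepFun (fun ω => I.restrict (fun u => ξ u ω 0))
        (fun ω => I.restrict (fun u => ξ u ω 1)) P :=
      hind.comp (Finset.measurable_restrict I) (Finset.measurable_restrict I)
    exact ((h1.hasGaussianLaw ((hξ.gaussian 0).hasGaussianLaw I)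
      ((hξ.gaussian 1).hasGaussianLaw I)).sub).smul (√2)⁻¹
  refine map_eq_of_covariance_eq (hξ.gaussian i) hG (hξ.measurable_coord i)
    (fun u => ((hξ.measurable_coord 0 u).sub (hξ.measurable_coord 1 u)).const_mul _) ?_ ?_
  · intro u
    rw [hξ.mean, integral_const_mul, integral_sub ((hξ.memLp 0 u).integrable one_le_two)
      ((hξ.memLp 1 u).integrable one_le_two), hξ.mean, hξ.mean]
    simp
  · intro u v
    have hc : ∀ u v, cov[fun ω => ξ u ω 0, fun ω => ξ v ω 1; P] = 0 := fun u v =>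
      (hind.comp (measurable_pi_apply u) (measurable_pi_apply v)).covariance_eq_zero
        (hξ.memLp 0 u) (hξ.memLp 1 v)
    rw [covariance_const_mul_left, covariance_const_mul_right,
      covariance_fun_sub_fun_sub (hξ.memLp 0 u) (hξ.memLp 1 u) (hξ.memLp 0 v) (hξ.memLp 1 v),
      hξ.cov_eq, hξ.cov_eq, hξ.cov_eq, hc, covariance_comm, hc, ← mul_assoc, ← mul_inv,
      Real.mul_self_sqrt zero_le_two]
    ring

/-- The random field is small with positive probability. -/
theorem measure_lipSmall_pos (hξ : IsGaussianField ξ P) (i : Fin 3) (R : ℝ) {ε : ℝ} (hε : 0 < ε) :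
    0 < P {ω | LipSmall (Metric.ball (0 : E3) R) ε fun u => ξ u ω i} := by
  have := (hξ.gaussian i).isProbabilityMeasure
  obtain ⟨𝒢, h𝒢, h𝒢c, hdense⟩ := exists_countable_c1_dense
    (𝒮 := {f : E3 → ℝ | ContDiff ℝ 1 f}) (fun f hf => hf) (isCompact_closedBall (0 : E3) R)
  set B := Metric.ball (0 : E3) R
  -- Almost every path is C¹, hence near some member of a countable family, so one of these events
  -- is not null.
  have hex : ∃ g ∈ 𝒢, 0 < P {ω | LipSmall B (ε / 2) ((fun u => ξ u ω 0) - g)} := by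
    by_contra! hcon
    have hnull : P (⋃ g ∈ 𝒢, {ω | LipSmall B (ε / 2) ((fun u => ξ u ω 0) - g)}) = 0 :=
      (measure_biUnion_null_iff h𝒢c).2 fun g hg => le_antisymm (hcon g hg) zero_le
    have hae : ∀ᵐ ω ∂P, ω ∈ ⋃ g ∈ 𝒢, {ω | LipSmall B (ε / 2) ((fun u => ξ u ω 0) - g)} := by
      filter_upwards [hξ.smooth_coord 0] with ω hω
      obtain ⟨g, hg, hclose⟩ := hdense _ hω (ε / 2) (half_pos hε)
      simp only [Set.mem_iUnion]
      refine ⟨g, hg, LipSmall.of_fderiv (convex_ball _ _)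
        ((hω.sub (show ContDiff ℝ 1 g from h𝒢 hg)).differentiable one_ne_zero) fun x hx => ?_⟩
      have h1 := hclose x (Metric.ball_subset_closedBall hx)
      refine ⟨h1.1, ?_⟩
      rw [fderiv_sub (hω.differentiable one_ne_zero x)
        ((show ContDiff ℝ 1 g from h𝒢 hg).differentiable one_ne_zero x)]
      exact h1.2
    have h1 : P (⋃ g ∈ 𝒢, {ω | LipSmall B (ε / 2) ((fun u => ξ u ω 0) - g)}) = 1 := by
      rw [← measure_univ (μ := P)]
      exact measure_congr (Filter.eventuallyEq_univ.2 hae)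
    rw [hnull] at h1
    exact zero_ne_one h1
  obtain ⟨g, -, hg⟩ := hex
  have hmeas := measurableSet_lipSmall B (ε / 2) g
  have h1 : P {ω | LipSmall B (ε / 2) ((fun u => ξ u ω 1) - g)} =
      P {ω | LipSmall B (ε / 2) ((fun u => ξ u ω 0) - g)} := by
    have h := congrArg (fun μ => μ {a | LipSmall B (ε / 2) (a - g)}) (hξ.map_path_eq 1 0)
    simp only [Measure.map_apply (hξ.measurable_path _) hmeas] at h
    exact h
  have hind : IndepFun (fun ω u => ξ u ω 0) (fun ω u => ξ u ω 1) P :=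
    hξ.indep.indepFun (by decide : (0 : Fin 3) ≠ 1)
  have h2 := hind.measure_inter_preimage_eq_mul _ _ hmeas hmeas
  have hmeas0 := measurableSet_lipSmall B ε (0 : E3 → ℝ)
  have h3 := congrArg (fun μ => μ {a | LipSmall B ε (a - 0)}) (hξ.map_path_eq_sub i)
  simp only [Measure.map_apply (hξ.measurable_path _) hmeas0] at h3
  have hdm : Measurable (fun ω u => (√2)⁻¹ * (ξ u ω 0 - ξ u ω 1)) :=
    measurable_pi_lambda _ fun u =>
      ((hξ.measurable_coord 0 u).sub (hξ.measurable_coord 1 u)).const_mul _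
  rw [Measure.map_apply hdm hmeas0] at h3
  simp only [sub_zero, Set.preimage_ofPred_eq] at h3 h2
  rw [h3]
  refine lt_of_lt_of_le ?_ (measure_mono (s := {ω | LipSmall B (ε / 2) ((fun u => ξ u ω 0) - g)} ∩
    {ω | LipSmall B (ε / 2) ((fun u => ξ u ω 1) - g)}) ?_)
  · rw [h2, h1]
    exact ENNReal.mul_pos hg.ne' hg.ne'
  · rintro ω ⟨ha, hb⟩
    have h4 := (ha.sub hb).smul (√2)⁻¹
    rw [sub_sub_sub_cancel_right, add_halves] at h4
    refine h4.mono ?_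
    have h5 : |(√2)⁻¹| ≤ 1 := by
      rw [abs_of_pos (by positivity)]
      exact inv_le_one_of_one_le₀ (Real.one_le_sqrt.2 one_le_two)
    nlinarith

end IsGaussianField

end RandomKnot

/-! ### The C¹ support of the field contains the kernel combinations. -/

namespace RandomKnot

variable {Ω : Type*} [MeasurableSpace Ω] {P : Measure Ω}

theorem gaussianReal_pos_of_isOpen (μ : ℝ) {v : ℝ≥0} (hv : v ≠ 0) {U : Set ℝ} (hU : IsOpen U)
    (hne : U.Nonempty) : 0 < gaussianReal μ v U := by
  rw [pos_iff_ne_zero]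
  intro h
  exact (hU.measure_pos volume hne).ne' (gaussianReal_absolutelyContinuous' μ hv h)

theorem exists_lipSmall_ball {F : E3 → ℝ} (hF : ContDiff ℝ 1 F) (R : ℝ) :
    ∃ M > 0, LipSmall (Metric.ball (0 : E3) R) M F := by
  obtain ⟨C₁, hC₁⟩ := (isCompact_closedBall (0 : E3) R).exists_bound_of_continuousOn
    hF.continuous.continuousOn
  obtain ⟨C₂, hC₂⟩ := (isCompact_closedBall (0 : E3) R).exists_bound_of_continuousOn
    (hF.continuous_fderiv one_ne_zero).continuousOn
  refine ⟨max (max C₁ C₂) 1, by positivity, LipSmall.of_fderiv (convex_ball _ _)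
    (hF.differentiable one_ne_zero) fun x hx => ⟨?_, ?_⟩⟩
  · exact (hC₁ x (Metric.ball_subset_closedBall hx)).trans
      ((le_max_left _ _).trans (le_max_left _ _))
  · exact (hC₂ x (Metric.ball_subset_closedBall hx)).trans
      ((le_max_right _ _).trans (le_max_left _ _))

namespace IsGaussianField

variable {ξ : E3 → Ω → E3}

/-- Every combination of covariance kernels lies in the `C¹` support of the random field. -/
theorem measure_lipSmall_sub_pos (hξ : IsGaussianField ξ P) (i : Fin 3) {F : E3 → ℝ}
    (hF : F ∈ kernelSpan) (R : ℝ) {ε : ℝ} (hε : 0 < ε) :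
    0 < P {ω | LipSmall (Metric.ball (0 : E3) R) ε ((fun u => ξ u ω i) - F)} := by
  have := (hξ.gaussian i).isProbabilityMeasure
  have hFd : ContDiff ℝ 1 F := (contDiff_of_mem_kernelSpan hF).of_le (by norm_num)
  obtain ⟨c, hcF⟩ := Finsupp.mem_span_range_iff_exists_finsupp.1 hF
  -- `F` is the covariance of the field with `Z`, as for elements of a Cameron–Martin space.
  set Z : Ω → ℝ := fun ω => ∑ u ∈ c.support, c u * ξ u ω i with hZ
  have hFv : ∀ v, F v = ∑ u ∈ c.support, c u * Real.exp (-‖v - u‖ ^ 2) := fun v => by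
    rw [← hcF, Finsupp.sum, Finset.sum_apply]
    simp
  have hZmem : MemLp Z 2 P := memLp_finsetSum _ fun u _ => (hξ.memLp i u).const_mul _
  have hcov : ∀ v, cov[fun ω => ξ v ω i, Z; P] = F v := fun v => by
    rw [covariance_fun_sum_right' (fun u _ => (hξ.memLp i u).const_mul _) (hξ.memLp i v), hFv]
    simp_rw [covariance_const_mul_right, hξ.cov_eq]
  set σ := Var[Z; P] with hσ
  by_cases hσ0 : σ = 0
  · have hF0 : F = 0 := by
      ext v
      have hc : Z =ᵐ[P] fun _ => P[Z] := ae_eq_integral_of_variance_eq_zero hZmem hσ0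
      rw [← hcov v, ProbabilityTheory.covariance, Pi.zero_apply]
      refine integral_eq_zero_of_ae ?_
      filter_upwards [hc] with ω hω
      simp [hω]
    rw [hF0]
    simpa using hξ.measure_lipSmall_pos i R hε
  have hσpos : 0 < σ := lt_of_le_of_ne (variance_nonneg _ _) (Ne.symm hσ0)
  -- The regression residual is uncorrelated with `Z`, hence independent of it by joint Gaussianity.
  -- The field is near `F` when ζ is small and `Z` is near σ.
  set ζ : E3 → Ω → ℝ := fun v ω => ξ v ω i - F v / σ * Z ω with hζ
  have hζmem : ∀ v, MemLp (ζ v) 2 P := fun v => (hξ.memLp i v).sub (hZmem.const_mul _)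
  have hjoint : IsGaussianProcess (Sum.elim ζ fun _ : Unit => Z) P := by
    classical
    refine IsGaussianProcess.of_isGaussianProcess (hξ.gaussian i) ?_
    have hLZ : ∀ I : Finset E3, c.support ⊆ I → ∃ L : (I → ℝ) →L[ℝ] ℝ,
        ∀ ω, L (I.restrict fun u => ξ u ω i) = Z ω := by
      intro I hI
      refine ⟨∑ u ∈ c.support.attach, c u • ContinuousLinearMap.proj (R := ℝ)
        (φ := fun _ : I => ℝ) ⟨u, hI u.2⟩, fun ω => ?_⟩
      simp [hZ, Finset.sum_attach c.support
        (fun u => c u * ξ u ω i)]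
    rintro (v | v)
    · obtain ⟨L, hL⟩ := hLZ (insert v c.support) (Finset.subset_insert _ _)
      refine ⟨insert v c.support, ContinuousLinearMap.proj (R := ℝ)
        (φ := fun _ : (insert v c.support : Finset E3) => ℝ) ⟨v, Finset.mem_insert_self _ _⟩ -
        (F v / σ) • L, fun ω => ?_⟩
      rw [sub_apply, smul_apply, hL]
      simp [hζ]
    · obtain ⟨L, hL⟩ := hLZ c.support subset_rfl
      exact ⟨c.support, L, fun ω => (hL ω).symm⟩
  have hind : IndepFun (fun ω v => ζ v ω) (fun ω (_ : Unit) => Z ω) P := by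
    refine hjoint.indepFun_of_covariance_eq_zero
      (fun v => (hζmem v).aestronglyMeasurable.aemeasurable)
      (fun _ => hZmem.aestronglyMeasurable.aemeasurable) fun v _ => ?_
    rw [covariance_fun_sub_left (hξ.memLp i v) (hZmem.const_mul _) hZmem, hcov,
      covariance_const_mul_left, covariance_self hZmem.aestronglyMeasurable.aemeasurable, ← hσ]
    field_simp
    ring
  obtain ⟨M, hM, hFM⟩ := exists_lipSmall_ball hFd R
  have hζpos : 0 < P {ω | LipSmall (Metric.ball (0 : E3) R) (ε / 2) fun v => ζ v ω} := by
    obtain ⟨R', hR'⟩ := c.support.finite_toSet.isBounded.subset_ball (0 : E3)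
    -- `Z` is built from values at the nodes, so the ball must contain them for smallness of the
    -- field to bound `Z`.
    set R'' := max R R'
    set S := ∑ u ∈ c.support, |c u|
    have hS : 0 ≤ S := Finset.sum_nonneg fun u _ => abs_nonneg _
    set δ := (ε / 2) / (1 + S / σ * M) with hδ
    have hden : 0 < 1 + S / σ * M := by positivity
    have hδ0 : 0 < δ := by positivity
    refine lt_of_lt_of_le (hξ.measure_lipSmall_pos i R'' hδ0) (measure_mono_ae ?_)
    filter_upwards [hξ.smooth_coord i] with ω hω hsmall
    replace hsmall : LipSmall (Metric.ball (0 : E3) R'') δ fun u => ξ u ω i := hsmall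
    have hall := hsmall.forall Metric.isOpen_ball hω.continuous
    have hZb : |Z ω| ≤ S * δ := by
      rw [hZ, Finset.sum_mul]
      refine (Finset.abs_sum_le_sum_abs _ _).trans (Finset.sum_le_sum fun u hu => ?_)
      rw [abs_mul]
      have hu' : u ∈ Metric.ball (0 : E3) R'' :=
        Metric.ball_subset_ball (le_max_right _ _) (hR' hu)
      exact mul_le_mul_of_nonneg_left (hall u hu' u hu').1 (abs_nonneg _)
    have h1 := (hsmall.mono_set (Metric.ball_subset_ball (le_max_left R R'))).sub
      (hFM.smul (Z ω / σ))
    have h2 : (fun v => ζ v ω) = (fun u => ξ u ω i) - (Z ω / σ) • F := by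
      ext v
      simp only [hζ, Pi.sub_apply, Pi.smul_apply, smul_eq_mul]
      ring
    change LipSmall _ _ (fun v => ζ v ω)
    rw [h2]
    refine h1.mono ?_
    rw [abs_div, abs_of_pos hσpos]
    calc δ + |Z ω| / σ * M ≤ δ + S * δ / σ * M := by gcongr
      _ = δ * (1 + S / σ * M) := by ring
      _ = ε / 2 := by rw [hδ]; field_simp
  have hZpos : 0 < P {ω | |Z ω / σ - 1| * M < ε / 2} := by
    have hZlaw : HasGaussianLaw Z P := hjoint.hasGaussianLaw_eval (Sum.inr ())
    have hopen : IsOpen {z : ℝ | |z / σ - 1| * M < ε / 2} :=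
      isOpen_lt (by fun_prop) continuous_const
    have h1 := gaussianReal_pos_of_isOpen P[Z] (v := σ.toNNReal)
      (by simpa using hσpos) hopen ⟨σ, by simp [hσ0, hε]⟩
    rwa [← hZlaw.map_eq_gaussianReal, Measure.map_apply_of_aemeasurable hZlaw.aemeasurable
      hopen.measurableSet] at h1
  have hmeas0 := measurableSet_lipSmall (Metric.ball (0 : E3) R) (ε / 2) (0 : E3 → ℝ)
  have hmeasZ : MeasurableSet {z : Unit → ℝ | |z () / σ - 1| * M < ε / 2} :=
    (isOpen_lt (by fun_prop) continuous_const).measurableSet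
  have hprod := hind.measure_inter_preimage_eq_mul _ _ hmeas0 hmeasZ
  simp only [sub_zero, Set.preimage_ofPred_eq] at hprod
  refine lt_of_lt_of_le ?_ (measure_mono (s :=
    {ω | LipSmall (Metric.ball (0 : E3) R) (ε / 2) fun v => ζ v ω} ∩
    {ω | |Z ω / σ - 1| * M < ε / 2}) ?_)
  · rw [hprod]
    exact ENNReal.mul_pos hζpos.ne' hZpos.ne'
  · rintro ω ⟨h1, h2⟩
    replace h1 : LipSmall (Metric.ball (0 : E3) R) (ε / 2) fun v => ζ v ω := h1
    have h3 := h1.add (hFM.smul (Z ω / σ - 1))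
    have h4 : (fun u => ξ u ω i) - F = (fun v => ζ v ω) + (Z ω / σ - 1) • F := by
      ext v
      simp only [hζ, Pi.sub_apply, Pi.add_apply, Pi.smul_apply, smul_eq_mul]
      ring
    change LipSmall _ _ ((fun u => ξ u ω i) - F)
    rw [h4]
    refine h3.mono ?_
    have h5 : |Z ω / σ - 1| * M < ε / 2 := h2
    linarith

end IsGaussianField

end RandomKnot

/-! ### Measurability of knot types, and their realization by kernel combinations. -/

namespace RandomKnot

/-- The regularity part of the definition of a knot. -/
def c2Loops : Set (ℝ → E3) :=
  {γ | ContDiff ℝ 2 γ ∧ Function.Periodic γ (2 * Real.pi)}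

theorem lipSmall_univ_of_periodic {f g : ℝ → E3} (hf : f ∈ c2Loops) (hg : g ∈ c2Loops) {ε : ℝ}
    (h : ∀ x ∈ Set.Icc 0 (2 * Real.pi),
      ‖f x - g x‖ ≤ ε ∧ ‖fderiv ℝ f x - fderiv ℝ g x‖ ≤ ε) :
    LipSmall Set.univ ε (f - g) := by
  have hfd : Differentiable ℝ f := hf.1.differentiable two_ne_zero
  have hgd : Differentiable ℝ g := hg.1.differentiable two_ne_zero
  have hper : ∀ k ∈ c2Loops, Function.Periodic (fderiv ℝ k) (2 * Real.pi) := fun k hk s => by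
    rw [← fderiv_comp_add_right]
    congr 1
    exact funext hk.2
  refine LipSmall.of_fderiv convex_univ (hfd.sub hgd) fun x _ => ?_
  have hp : Function.Periodic (fun x => ((f x, g x), (fderiv ℝ f x, fderiv ℝ g x)))
      (2 * Real.pi) := fun x => by
    simp only [hf.2 x, hg.2 x, hper f hf x, hper g hg x]
  obtain ⟨y, hy, hxy⟩ := hp.exists_mem_Ico₀ Real.two_pi_pos x
  simp only [Prod.mk.injEq] at hxy
  have h1 := h y (Set.Ico_subset_Icc_self hy)
  rw [fderiv_sub (hfd x) (hgd x), Pi.sub_apply, hxy.1.1, hxy.1.2, hxy.2.1, hxy.2.2]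
  exact h1

/-- Among the `C²` loops, those of a given knot type are cut out by a measurable condition. -/
theorem exists_measurableSet_hasType (G : ℝ → E3) :
    ∃ V : Set (ℝ → E3), MeasurableSet V ∧ ∀ γ ∈ c2Loops, γ ∈ V ↔ HasType γ G := by
  obtain ⟨𝒢, h𝒢, h𝒢c, hdense⟩ := exists_countable_c1_dense (𝒮 := c2Loops)
    (fun f hf => hf.1.of_le (by norm_num)) (isCompact_Icc (a := (0 : ℝ)) (b := 2 * Real.pi))
  -- C¹ balls whose loops all have the given type. The centre must come from a countable dense set
  -- of loops and need not be tied to G in any other way.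
  let good : (ℝ → E3) → ℕ → Prop := fun g k =>
    ∀ γ ∈ c2Loops, LipSmall Set.univ (1 / ((k : ℝ) + 1)) (γ - g) → HasType γ G
  refine ⟨⋃ g ∈ 𝒢, ⋃ k : ℕ, ⋃ _ : good g k, {a | LipSmall Set.univ (1 / ((k : ℝ) + 1)) (a - g)},
    MeasurableSet.biUnion h𝒢c fun g _ => MeasurableSet.iUnion fun k => MeasurableSet.iUnion
      fun _ => measurableSet_lipSmall _ _ _, fun γ hγ => ⟨fun hmem => ?_, fun hG => ?_⟩⟩
  · simp only [Set.mem_iUnion] at hmem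
    obtain ⟨g, -, k, hgood, hclose⟩ := hmem
    exact hgood γ hγ hclose
  · obtain ⟨ε, hε, hstable⟩ := hG.1.exists_stable
    obtain ⟨k, hk⟩ := exists_nat_one_div_lt (show (0 : ℝ) < ε / 2 by positivity)
    obtain ⟨g, hg, hclose⟩ := hdense γ hγ (1 / ((k : ℝ) + 1)) (by positivity)
    have h1 := lipSmall_univ_of_periodic hγ (h𝒢 hg) hclose
    simp only [Set.mem_iUnion]
    refine ⟨g, hg, k, fun γ' hγ' hclose' => ?_, h1⟩
    have h2 := hclose'.sub h1
    rw [sub_sub_sub_cancel_right] at h2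
    have h3 := h2.forall isOpen_univ (hγ'.1.continuous.sub hγ.1.continuous)
    have h4 := hstable γ' hγ'.1 hγ'.2 (LipschitzWith.of_dist_le_mul fun s s' => by
      rw [dist_eq_norm, dist_eq_norm]
      refine (h3 s trivial s' trivial).2.trans ?_
      gcongr
      linarith)
    exact ⟨h4.1, h4.2.trans hG.2⟩

theorem norm_le_of_forall_abs_le {v : E3} {κ : ℝ} (h : ∀ i, |v i| ≤ κ) : ‖v‖ ≤ 3 * κ := by
  have hκ : 0 ≤ κ := (abs_nonneg _).trans (h 0)
  have h1 : ‖v‖ ^ 2 ≤ (3 * κ) ^ 2 := by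
    rw [EuclideanSpace.real_norm_sq_eq, Fin.sum_univ_three]
    have h2 : ∀ i, v i ^ 2 ≤ κ ^ 2 := fun i => sq_le_sq.2 ((h i).trans (le_abs_self κ))
    nlinarith [h2 0, h2 1, h2 2]
  exact abs_le_of_sq_le_sq' h1 (by positivity) |>.2

theorem coord_mem_c1Periodic {ι : Type*} {γ : ι → ℝ → E3} (hγ : ∀ j, IsKnot (γ j)) (i : Fin 3) :
    (fun j s => γ j s i) ∈ c1Periodic ι :=
  pullback_mem_c1Periodic hγ (F := fun x => x i) (by fun_prop)

theorem exists_bound_of_isKnot {ι : Type*} [Finite ι] {γ : ι → ℝ → E3} (hγ : ∀ j, IsKnot (γ j)) :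
    ∃ C, 0 < C ∧ ∀ j s, ‖γ j s‖ ≤ C ∧ ‖deriv (γ j) s‖ ≤ C := by
  choose C hC hb using fun i => exists_bound_of_mem_c1Periodic (coord_mem_c1Periodic hγ i)
  obtain ⟨k, hk⟩ := Finite.exists_max C
  refine ⟨3 * C k, by linarith [hC k], fun j s => ⟨norm_le_of_forall_abs_le fun i =>
    ((hb i j s).1.trans (hk i)), norm_le_of_forall_abs_le fun i => ?_⟩⟩
  have h1 : HasDerivAt (γ j) (deriv (γ j) s) s :=
    ((hγ j).contDiff.differentiable two_ne_zero s).hasDerivAt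
  have h2 : HasDerivAt (fun s => γ j s i) (deriv (γ j) s i) s :=
    (EuclideanSpace.proj (𝕜 := ℝ) i).hasFDerivAt.comp_hasDerivAt s h1
  rw [← h2.deriv]
  exact (hb i j s).2.trans (hk i)

/-- Maps that are close to a suitable combination of kernels carry the components of a link, and
their small translates, to knots of prescribed types. -/
theorem IsLink.exists_kernelSpan_hasType {ι : Type*} [Finite ι] [Nonempty ι] {γ G : ι → ℝ → E3}
    (hγ : IsLink γ) (hG : ∀ j, IsKnot (G j)) :
    ∃ F : Fin 3 → E3 → ℝ, (∀ i, F i ∈ kernelSpan) ∧ ∃ R : ℝ, ∃ δ > 0, ∃ δ' > 0,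
      ∀ a : E3 → E3, ContDiff ℝ 2 a →
        (∀ i, LipSmall (Metric.ball (0 : E3) R) δ ((fun u => a u i) - F i)) →
        ∀ j v, ‖v‖ < δ' → HasType (fun s => a (γ j s + v)) (G j) := by
  choose ε' hε' hstable using fun j => (hG j).exists_stable
  obtain ⟨k, hk⟩ := Finite.exists_min ε'
  have hε : (0 : ℝ) < ε' k := hε' k
  -- In each coordinate three errors of size κ add up: `a` against `F`, the translation by v, and
  -- `F` against `G`. Passing from coordinates to the norm costs another factor 3.
  set κ : ℝ := ε' k / 9 with hκdef
  have hκ : 0 < κ := by positivity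
  choose F hF hFG using fun i => hγ.exists_kernelSpan_close (coord_mem_c1Periodic hG i) hκ
  have hFd : ∀ i, ContDiff ℝ 2 (F i) := fun i => contDiff_of_mem_kernelSpan (hF i)
  obtain ⟨L, hL, hbound⟩ := exists_bound_of_isKnot hγ.isKnot
  have hcont : Continuous fun x => fun i => fderiv ℝ (F i) x :=
    continuous_pi fun i => (hFd i).continuous_fderiv two_ne_zero
  obtain ⟨η, hη, hηF⟩ := Metric.uniformContinuousOn_iff.1
    ((isCompact_closedBall (0 : E3) (L + 1)).uniformContinuousOn_of_continuous hcont.continuousOn)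
    (κ / L) (by positivity)
  -- The ball of radius L + 1 contains the translates by ‖v‖ < 1, and speed at most L turns κ / L
  -- into κ.
  refine ⟨F, hF, L + 1, κ / L, by positivity, min η 1, by positivity,
    fun a ha hclose j v hv => ?_⟩
  have hγc := (hγ.isKnot j).contDiff
  have hγd : ∀ s, HasDerivAt (γ j) (deriv (γ j) s) s := fun s =>
    (hγc.differentiable two_ne_zero s).hasDerivAt
  have hmem : ∀ s, γ j s + v ∈ Metric.ball (0 : E3) (L + 1) := fun s => by
    rw [mem_ball_zero_iff]
    have h1 := norm_add_le (γ j s) v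
    have h2 := (hbound j s).1
    have h3 := hv.trans_le (min_le_right _ _)
    linarith
  have hmem' : ∀ s, γ j s ∈ Metric.closedBall (0 : E3) (L + 1) := fun s => by
    rw [mem_closedBall_zero_iff]
    linarith [(hbound j s).1]
  refine hstable j _ (ha.comp (hγc.add contDiff_const))
    (fun s => by rw [(hγ.isKnot j).periodic s]) (LipschitzWith.of_dist_le_mul fun s s' => ?_)
  rw [dist_eq_norm, Real.dist_eq]
  have h1 : ∀ i, |a (γ j s + v) i - F i (γ j s + v) - (a (γ j s' + v) i - F i (γ j s' + v))| ≤
      κ * |s - s'| := by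
    intro i
    have hai : ContDiff ℝ 2 fun u => a u i := (EuclideanSpace.proj (𝕜 := ℝ) i).contDiff.comp ha
    have h := ((hclose i).forall Metric.isOpen_ball (hai.continuous.sub (hFd i).continuous)
      _ (hmem s) _ (hmem s')).2
    have hlip := convex_univ.norm_image_sub_le_of_norm_hasDerivWithin_le
      (fun x _ => (hγd x).hasDerivWithinAt) (fun x _ => (hbound j x).2)
      (Set.mem_univ s') (Set.mem_univ s)
    rw [add_sub_add_right_eq_sub] at h
    refine h.trans ?_
    calc κ / L * ‖γ j s - γ j s'‖ ≤ κ / L * (L * ‖s - s'‖) := by gcongr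
      _ = κ * |s - s'| := by rw [Real.norm_eq_abs]; field_simp
  have h2 : ∀ i, |F i (γ j s + v) - F i (γ j s) - (F i (γ j s' + v) - F i (γ j s'))| ≤
      κ * |s - s'| := by
    intro i
    have hd : ∀ r, HasDerivAt (fun r => F i (γ j r + v) - F i (γ j r))
        (fderiv ℝ (F i) (γ j r + v) (deriv (γ j) r) - fderiv ℝ (F i) (γ j r) (deriv (γ j) r)) r :=
      fun r => (((hFd i).differentiable two_ne_zero _).hasFDerivAt.comp_hasDerivAt r
        ((hγd r).add_const v)).sub
        (((hFd i).differentiable two_ne_zero _).hasFDerivAt.comp_hasDerivAt r (hγd r))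
    refine convex_univ.norm_image_sub_le_of_norm_hasDerivWithin_le
      (fun x _ => (hd x).hasDerivWithinAt) (fun r _ => ?_) (Set.mem_univ s') (Set.mem_univ s)
    rw [← sub_apply]
    refine (ContinuousLinearMap.le_opNorm _ _).trans ?_
    have h := hηF _ (Metric.ball_subset_closedBall (hmem r)) _ (hmem' r) (by
      rw [dist_eq_norm, add_sub_cancel_left]
      exact hv.trans_le (min_le_left _ _))
    have h' := ((dist_le_pi_dist _ _ i).trans h.le)
    rw [dist_eq_norm] at h'
    calc _ ≤ κ / L * L := by
          gcongr
          exact (hbound j r).2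
      _ = κ := by field_simp
  have h3 : ∀ i, |F i (γ j s) - G j s i - (F i (γ j s') - G j s' i)| ≤ κ * |s - s'| := by
    intro i
    have hFp := pullback_mem_c1Periodic hγ.isKnot ((hFd i).of_le one_le_two)
    have hGp := coord_mem_c1Periodic hG i
    exact convex_univ.norm_image_sub_le_of_norm_hasDerivWithin_le
      (f := fun r => F i (γ j r) - G j r i)
      (fun x _ => ((hasDerivAt_of_mem_c1Periodic hFp j x).sub
        (hasDerivAt_of_mem_c1Periodic hGp j x)).hasDerivWithinAt)
      (fun r _ => (hFG i j r).2) (Set.mem_univ s') (Set.mem_univ s)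
  have h4 : ∀ i, |(a (γ j s + v) - G j s - (a (γ j s' + v) - G j s')) i| ≤
      3 * (κ * |s - s'|) := by
    intro i
    have e : (a (γ j s + v) - G j s - (a (γ j s' + v) - G j s')) i =
        (a (γ j s + v) i - F i (γ j s + v) - (a (γ j s' + v) i - F i (γ j s' + v))) +
        (F i (γ j s + v) - F i (γ j s) - (F i (γ j s' + v) - F i (γ j s'))) +
        (F i (γ j s) - G j s i - (F i (γ j s') - G j s' i)) := by
      simp only [PiLp.sub_apply]
      ring
    rw [e]
    refine (abs_add_three _ _ _).trans ?_
    linarith [h1 i, h2 i, h3 i]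
  refine (norm_le_of_forall_abs_le h4).trans ?_
  have h5 : (ε' k : ℝ) ≤ ε' j := hk j
  calc 3 * (3 * (κ * |s - s'|)) = ε' k * |s - s'| := by rw [hκdef]; ring
    _ ≤ _ := by gcongr

end RandomKnot

/-! ### The knot and its displaced copy, joint positivity, and the theorem. -/

namespace RandomKnot

theorem IsKnot.rigidMotion {f : ℝ → E3} (hf : IsKnot f) {U : E3 →L[ℝ] E3}
    (hU : ∀ x, ‖U x‖ = ‖x‖) (m b : E3) : IsKnot fun s => m + U (f s - m) + b where
  contDiff := (contDiff_const.add (U.contDiff.comp (hf.contDiff.sub contDiff_const))).add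
    contDiff_const
  periodic s := by simp only [hf.periodic s]
  injOn s hs s' hs' h := by
    have h1 : U (f s - m) = U (f s' - m) := add_left_cancel (add_right_cancel h)
    rw [← sub_eq_zero, ← map_sub, ← norm_eq_zero, hU, norm_eq_zero, sub_sub_sub_cancel_right,
      sub_eq_zero] at h1
    exact hf.injOn hs hs' h1
  deriv_ne_zero s := by
    have h1 : HasDerivAt f (deriv f s) s :=
      (hf.contDiff.differentiable two_ne_zero s).hasDerivAt
    have h2 := ((U.hasFDerivAt.comp_hasDerivAt s (h1.sub_const m)).const_add m).add_const b
    have h3 : deriv (fun s => m + U (f s - m) + b) s = U (deriv f s) := h2.deriv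
    rw [h3, ← norm_ne_zero_iff, hU, norm_ne_zero_iff]
    exact hf.deriv_ne_zero s

/-- A knot and a rigid copy of it, translated far enough, form a link. -/
theorem IsKnot.exists_isLink {f : ℝ → E3} (hf : IsKnot f) {U : E3 →L[ℝ] E3}
    (hU : ∀ x, ‖U x‖ = ‖x‖) (m : E3) :
    ∃ b : E3, IsLink fun (j : Bool) s => if j then m + U (f s - m) + b else f s := by
  obtain ⟨C, hC, hb⟩ := exists_bound_of_isKnot (ι := Unit) (γ := fun _ => f) fun _ => hf
  set D := C + ‖m‖
  have hD : ∀ s, ‖f s - m‖ ≤ D := fun s => (norm_sub_le _ _).trans (by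
    simpa [D] using (hb () s).1)
  have hD0 : 0 < D := by positivity
  -- Before translation both curves lie within D of m, so a shift longer than 2D separates them.
  have key : ∀ s s', m + U (f s - m) + EuclideanSpace.single 0 (2 * D + 1) ≠ f s' := by
    intro s s' h
    have h1 : EuclideanSpace.single 0 (2 * D + 1) = (f s' - m) - U (f s - m) := by
      rw [← h]
      abel
    have h2 := norm_sub_le (f s' - m) (U (f s - m))
    rw [← h1, hU, PiLp.norm_single, Real.norm_eq_abs, abs_of_pos (by positivity)] at h2
    linarith [hD s, hD s']
  refine ⟨EuclideanSpace.single 0 (2 * D + 1), ⟨?_, ?_⟩⟩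
  · rintro (_ | _)
    · simpa using hf
    · simpa using hf.rigidMotion hU m _
  · rintro (_ | _) (_ | _) s s' h
    · rfl
    · exact absurd (by simpa using h.symm) (key s' s)
    · exact absurd (by simpa using h) (key s s')
    · rfl

variable {Ω : Type*} [MeasurableSpace Ω] {P : Measure Ω}

theorem IsWiener.measure_ball_pos {w : ℝ≥0 → Ω → E3} (hw : IsWiener w P) {t : ℝ≥0} (ht : t ≠ 0)
    (b : E3) {δ : ℝ} (hδ : 0 < δ) : 0 < P {ω | ‖w t ω - b‖ < δ} := by
  have hpos : ∀ i, 0 < P ((fun ω r => w r ω i) ⁻¹' {φ : ℝ≥0 → ℝ | |φ t - b i| < δ / 4}) := by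
    intro i
    have hlaw := (hw.brownian i).hasLaw_eval t
    have hopen : IsOpen {z : ℝ | |z - b i| < δ / 4} := isOpen_lt (by fun_prop) continuous_const
    have h1 := gaussianReal_pos_of_isOpen 0 ht hopen ⟨b i, by simpa using hδ⟩
    rwa [← hlaw.map_eq, Measure.map_apply_of_aemeasurable hlaw.aemeasurable
      hopen.measurableSet] at h1
  have hmeas : ∀ i : Fin 3, MeasurableSet {φ : ℝ≥0 → ℝ | |φ t - b i| < δ / 4} := fun i =>
    have hopen : IsOpen {z : ℝ | |z - b i| < δ / 4} := isOpen_lt (by fun_prop) continuous_const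
    hopen.measurableSet.preimage (measurable_pi_apply t)
  have hprod := hw.indep.measure_inter_preimage_eq_mul Finset.univ fun i _ => hmeas i
  refine lt_of_lt_of_le ?_ (measure_mono (s := ⋂ i ∈ (Finset.univ : Finset (Fin 3)),
    (fun ω r => w r ω i) ⁻¹' {φ : ℝ≥0 → ℝ | |φ t - b i| < δ / 4}) ?_)
  · rw [hprod, pos_iff_ne_zero, Finset.prod_ne_zero_iff]
    exact fun i _ => (hpos i).ne'
  · intro ω hω
    simp only [Set.mem_iInter] at hω
    have h1 : ∀ i, |(w t ω - b) i| ≤ δ / 4 := fun i => le_of_lt (hω i (Finset.mem_univ i))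
    have h2 := norm_le_of_forall_abs_le h1
    change ‖w t ω - b‖ < δ
    linarith

theorem IsGaussianField.measure_forall_lipSmall_pos {ξ : E3 → Ω → E3} (hξ : IsGaussianField ξ P)
    {F : Fin 3 → E3 → ℝ} (hF : ∀ i, F i ∈ kernelSpan) (R : ℝ) {δ : ℝ} (hδ : 0 < δ) :
    0 < P {ω | ∀ i, LipSmall (Metric.ball (0 : E3) R) δ ((fun u => ξ u ω i) - F i)} := by
  have hprod := hξ.indep.measure_inter_preimage_eq_mul Finset.univ
    fun i _ => measurableSet_lipSmall (Metric.ball (0 : E3) R) δ (F i)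
  have hset : {ω | ∀ i, LipSmall (Metric.ball (0 : E3) R) δ ((fun u => ξ u ω i) - F i)} =
      ⋂ i ∈ (Finset.univ : Finset (Fin 3)), (fun ω u => ξ u ω i) ⁻¹'
        {a : E3 → ℝ | LipSmall (Metric.ball (0 : E3) R) δ (a - F i)} := by
    ext ω
    simp
  rw [hset, hprod, pos_iff_ne_zero, Finset.prod_ne_zero_iff]
  exact fun i _ => (hξ.measure_lipSmall_sub_pos i (hF i) R hδ).ne'

/-- The random field is close to a given combination of covariance kernels and the Wiener process
is close to a given point, simultaneously with positive probability. -/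
theorem IsGaussianField.measure_lipSmall_inter_ball_pos {ξ : E3 → Ω → E3}
    (hξ : IsGaussianField ξ P) {w : ℝ≥0 → Ω → E3} (hw : IsWiener w P)
    (hind : IndepFun (fun ω u => ξ u ω) (fun ω t => w t ω) P)
    {F : Fin 3 → E3 → ℝ} (hF : ∀ i, F i ∈ kernelSpan) (R : ℝ) {δ : ℝ} (hδ : 0 < δ)
    {t : ℝ≥0} (ht : t ≠ 0) (b : E3) {δ' : ℝ} (hδ' : 0 < δ') :
    0 < P ({ω | ∀ i, LipSmall (Metric.ball (0 : E3) R) δ ((fun u => ξ u ω i) - F i)} ∩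
      {ω | ‖w t ω - b‖ < δ'}) := by
  have hmeasF : MeasurableSet {a : E3 → E3 |
      ∀ i, LipSmall (Metric.ball (0 : E3) R) δ ((fun u => a u i) - F i)} := by
    simp only [Set.ofPred_forall]
    refine MeasurableSet.iInter fun i => ?_
    have hcoord : Measurable fun (a : E3 → E3) u => a u i := measurable_pi_lambda _ fun u =>
      (EuclideanSpace.proj (𝕜 := ℝ) i).continuous.measurable.comp (measurable_pi_apply u)
    exact (measurableSet_lipSmall (Metric.ball (0 : E3) R) δ (F i)).preimage hcoord
  have hmeasw : MeasurableSet {φ : ℝ≥0 → E3 | ‖φ t - b‖ < δ'} :=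
    have hopen : IsOpen {y : E3 | ‖y - b‖ < δ'} := isOpen_lt (by fun_prop) continuous_const
    hopen.measurableSet.preimage (measurable_pi_apply t)
  have hprod := hind.measure_inter_preimage_eq_mul _ _ hmeasF hmeasw
  simp only [Set.preimage_ofPred_eq] at hprod
  have h1 := hξ.measure_forall_lipSmall_pos hF R hδ
  have h2 := hw.measure_ball_pos ht b hδ'
  rw [hprod]
  exact ENNReal.mul_pos h1.ne' h2.ne'

/-- A random field evaluated at a random point is measurable up to a null set, even along
uncountable families of points. -/
theorem IsGaussianField.exists_measurable_path {ξ : E3 → Ω → E3} (hξ : IsGaussianField ξ P)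
    {Y : ℝ → Ω → E3} (hY : ∀ s, Measurable (Y s)) :
    ∃ Γ : Ω → ℝ → E3, Measurable Γ ∧ ∀ᵐ ω ∂P, ∀ s, Γ ω s = ξ (Y s ω) ω := by
  classical
  obtain ⟨N, hN, hNm, hNs⟩ := hξ.smooth.exists_measurable_mem
  -- Set to zero off a full-measure set, the field is continuous in u for every ω, hence jointly
  -- measurable and composable with a random point.
  let ξ' : E3 → Ω → E3 := fun u => N.indicator (ξ u)
  have hξ' : Measurable (Function.uncurry ξ') := by
    refine measurable_uncurry_of_continuous_of_measurable (fun ω => ?_)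
      fun u => (hξ.measurable u).indicator hNm
    by_cases hω : ω ∈ N
    · simpa [ξ', hω] using (hNs ω hω).continuous
    · simpa [ξ', hω] using continuous_const
  refine ⟨fun ω s => ξ' (Y s ω) ω, measurable_pi_lambda _ fun s =>
    hξ'.comp ((hY s).prodMk measurable_id), ?_⟩
  filter_upwards [hN] with ω hω s
  simp [ξ', hω]

end RandomKnot

theorem theorem3p2 {Ω : Type*} [MeasurableSpace Ω] (P : Measure Ω) [IsProbabilityMeasure P]
    (ξ : RandomKnot.E3 → Ω → RandomKnot.E3) (hξ : RandomKnot.IsGaussianField ξ P)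
    (w : ℝ≥0 → Ω → RandomKnot.E3) (hw : RandomKnot.IsWiener w P)
    (hind : IndepFun (fun ω u => ξ u ω) (fun ω t => w t ω) P)
    (A : RandomKnot.E3 →L[ℝ] RandomKnot.E3) (hA : RandomKnot.GeneratesOrthogonal A)
    (f₀ : ℝ → RandomKnot.E3) (hf₀ : RandomKnot.IsKnot f₀)
    (x : RandomKnot.E3 → ℝ≥0 → Ω → RandomKnot.E3)
    (hx : RandomKnot.IsSolution A (RandomKnot.visitationMeasure f₀) w x P)
    (G₁ G₂ : ℝ → RandomKnot.E3) (hG₁ : RandomKnot.IsKnot G₁) (hG₂ : RandomKnot.IsKnot G₂)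
    (hG : ¬ RandomKnot.SameType G₁ G₂) :
    ∃ t₀ : ℝ≥0, 0 < t₀ ∧
      NullMeasurableSet
        {ω | RandomKnot.HasType (RandomKnot.movingKnot ξ x f₀ 0 ω) G₁ ∧
          RandomKnot.HasType (RandomKnot.movingKnot ξ x f₀ t₀ ω) G₂} P ∧
      0 < P {ω | RandomKnot.HasType (RandomKnot.movingKnot ξ x f₀ 0 ω) G₁ ∧
          RandomKnot.HasType (RandomKnot.movingKnot ξ x f₀ t₀ ω) G₂} ∧
      ∀ ω, RandomKnot.HasType (RandomKnot.movingKnot ξ x f₀ 0 ω) G₁ ∧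
          RandomKnot.HasType (RandomKnot.movingKnot ξ x f₀ t₀ ω) G₂ →
        ¬ RandomKnot.SameType (RandomKnot.movingKnot ξ x f₀ 0 ω)
          (RandomKnot.movingKnot ξ x f₀ t₀ ω) := by
  open RandomKnot in
  obtain ⟨U, hU0, hU, hUorth⟩ := hA
  set m : E3 := ∫ v, v ∂(visitationMeasure f₀)
  have hflow : ∀ᵐ ω ∂P, ∀ u t, x u t ω = m + U t (u - m) + w t ω := by
    filter_upwards [hx] with ω hω u t
    exact flow_eq (x := fun u t => x u t ω) (w := fun t => w t ω) hU0 hU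
      hf₀.contDiff.continuous hω.1 hω.2 u t
  have hw0 : ∀ᵐ ω ∂P, w 0 ω = 0 := by
    have h : ∀ᵐ ω ∂P, ∀ i, w 0 ω i = 0 :=
      ae_all_iff.2 fun i => (hw.brownian i).eval_zero_ae_eq_zero
    filter_upwards [h] with ω hω
    ext i
    simpa using hω i
  have hsmooth : ∀ᵐ ω ∂P, ContDiff ℝ 2 fun u => ξ u ω := by
    filter_upwards [hξ.smooth] with ω hω
    exact contDiff_infty.1 hω 2
  have hΓ : ∀ᵐ ω ∂P, ∀ t : ℝ≥0,
      movingKnot ξ x f₀ t ω = fun s => ξ (m + U t (f₀ s - m) + w t ω) ω := by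
    filter_upwards [hflow] with ω hω t
    ext1 s
    simp only [movingKnot, hω]
  have hloop : ∀ᵐ ω ∂P, ∀ t : ℝ≥0, movingKnot ξ x f₀ t ω ∈ c2Loops := by
    filter_upwards [hΓ, hsmooth] with ω h1 h2 t
    rw [h1 t]
    refine ⟨h2.comp ((contDiff_const.add ((U t).contDiff.comp
      (hf₀.contDiff.sub contDiff_const))).add contDiff_const), fun s => ?_⟩
    simp only [hf₀.periodic s]
  have hnull : ∀ (G : ℝ → E3) (t : ℝ≥0),
      NullMeasurableSet {ω | HasType (movingKnot ξ x f₀ t ω) G} P := by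
    intro G t
    obtain ⟨V, hV, hVG⟩ := exists_measurableSet_hasType G
    obtain ⟨Γ, hΓm, hΓe⟩ := hξ.exists_measurable_path
      (Y := fun s ω => m + U t (f₀ s - m) + w t ω) fun s => (hw.measurable t).const_add _
    refine (hV.preimage hΓm).nullMeasurableSet.congr ?_
    filter_upwards [hΓ, hΓe, hloop] with ω h1 h2 h3
    have h4 : Γ ω = movingKnot ξ x f₀ t ω := by
      rw [h1 t]
      exact funext h2
    change (Γ ω ∈ V) = HasType (movingKnot ξ x f₀ t ω) G
    rw [h4]
    exact propext (hVG _ (h3 t))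
  -- The time 1 is arbitrary: w(t) charges every ball at each t > 0.
  refine ⟨1, one_pos, (hnull G₁ 0).inter (hnull G₂ 1), ?_, ?_⟩
  · have hUnorm : ∀ y, ‖U (1 : ℝ≥0) y‖ = ‖y‖ :=
      fun y => ContinuousLinearMap.norm_map_of_mem_unitary (hUorth _ (NNReal.coe_nonneg 1)) y
    obtain ⟨b, hlink⟩ := hf₀.exists_isLink hUnorm m
    obtain ⟨F, hF, R, δ, hδ, δ', hδ', hclose⟩ := hlink.exists_kernelSpan_hasType
      (G := fun j => if j then G₂ else G₁) (by rintro (_ | _) <;> simpa)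
    have hpos := hξ.measure_lipSmall_inter_ball_pos hw hind hF R hδ one_ne_zero b hδ'
    refine hpos.trans_le (measure_mono_ae ?_)
    filter_upwards [hΓ, hw0, hsmooth] with ω h1 h2 h3
    rintro ⟨h4, h5⟩
    have h6 := hclose (fun u => ξ u ω) h3 h4
    constructor
    -- At time 0 the curve is the first component itself; at time 1 it is the second one translated
    -- by the small vector w(1) - b.
    · have h7 := h6 false 0 (by simpa using hδ')
      rw [h1 0, h2]
      simpa [hU0] using h7
    · have h7 := h6 true (w 1 ω - b) h5
      rw [h1 1]
      simpa using h7
  · rintro ω ⟨h1, h2⟩ h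
    exact hG ((h1.2.symm.trans h).trans h2.2)
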